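/- For a real number $x$ let $\|x\|$ be the distance from $x$ to the nearest integer and $\lceil x\rceil$ the smallest integer not less than $x$. Let $P(X)=a_dX^d+\cdots+a_0\in\mathbb Z[X]$ be an irreducible polynomial with $d\ge 1$, $a_d\ge 1$, $\gcd(a_d,\ldots,a_0)=1$, $a_0\neq 0$, without multiple roots, each of whose irreducible factors in $\mathbb Z[X]$ has at least one root of modulus greater than $1$. Let $\alpha_1,\ldots,\alpha_d$ be its complex roots, ordered so that $|\alpha_i|>1$ for $1\le i\le p$ and $|\alpha_i|\le 1$ for $p+1\le i\le d$. For an integer $k\ge 0$ let $\Xi_k$ be the set of tuples $\boldsymbol g=(g_1,\ldots,g_p)$ of polynomials in $\mathbb C[X]$ with $\deg g_i\le k$ such that $g_j=\overline{g_i}$ (coefficientwise conjugation) whenever $\alpha_j=\overline{\alpha_i}$, $1\le i,j\le p$ (in particular $g_i\in\mathbb R[X]$ if $\alpha_i\in\mathbb R$). Put $$x_n(\boldsymbol g)=\sum_{i=1}^p g_i(n)\alpha_i^n\in\mathbb R,\qquad \mathcal L^{(k)}(P)=\Bigl\{\limsup_{n\to\infty}\|x_n(\boldsymbol g)\| \;:\;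 \boldsymbol g\in\Xi_k\Bigr\}.$$ Suppose that $P$ is monic and hyperbolic, i.e. $|\alpha_i|\ne 1$ for all $i$. Let $$\beta_1=\min_{1\le i\le p}|\alpha_i|,\qquad \beta_2=\min_{p+1\le i\le d}|\alpha_i|^{-1},\qquad \beta=\min\{\beta_1,\beta_2\},$$ where $\beta_2=+\infty$ if $p=d$, and for $n\in\mathbb Z$ let $$\rho_n=\frac{-1}{2\pi i}\int_{|z|=R}\frac{z^{n-1}}{P(z)}\,dz ,$$ the circle being positively oriented and $R>1$ so close to $1$ that $P$ has no root with $1<|z|\le R$. (1) For every integer $k\ge0$, $1/2$ is an accumulation point of $\mathcal L^{(k)}(P)$. (2) Assume that either $\beta=|\alpha_i|$ for exactly one index $i\in\{1,\dots,p\}$, or $\beta=|\alpha_i|^{-1}$ for exactly one index $i\in\{p+1,\dots,d\}$, and that $$\Bigl\lceil\frac{\beta-1}{2}\Bigr\rceil\sum_{n\in\mathbb Z}|\rho_n|<\frac12 .$$ Then there are intervals $[c_i,d_i]\subset\mathcal L^{(0)}(P)$ with $c_i<d_i$ $(i=1,2,\ldots)$ and $\lim_{i\to\infty}c_i=1/2$.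 (3) Assume that $\beta_1=|\alpha_i|$ for exactly one index $i\in\{1,\dots,p\}$, that $\beta_2=|\alpha_i|^{-1}$ for exactly one index $i\in\{p+1,\dots,d\}$ (in particular $p<d$), and that $$\Bigl\lceil\frac{\widetilde\beta-1}{2}\Bigr\rceil\sum_{n\in\mathbb Z}|\rho_n|<\frac12,\qquad \widetilde\beta=\max\{\beta_1,\beta_2\}.$$ Then there is a $v<1/2$ with $[v,1/2]\subset\mathcal L^{(0)}(P)$. -/

import Mathlib

open Polynomial Filter Topology

noncomputable section

namespace MarkoffLagrange

/-- The set of complex roots of an integer polynomial `P`. -/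
def complexRoots (P : ℤ[X]) : Finset ℂ := (P.aroots ℂ).toFinset

/-- The expanding roots of `P`: those of modulus greater than `1`. -/
def expandingRoots (P : ℤ[X]) : Finset ℂ := (complexRoots P).filter fun α => 1 < ‖α‖

/-- The non-expanding roots of `P`: those of modulus at most `1`. -/
def nonexpandingRoots (P : ℤ[X]) : Finset ℂ := (complexRoots P).filter fun α => ‖α‖ ≤ 1

/-- The standing assumptions on the integer polynomial `P`. -/
structure Admissible (P : ℤ[X]) : Prop where
  irreducible : Irreducible P
  one_le_natDegree : 1 ≤ P.natDegree
  one_le_leadingCoeff : 1 ≤ P.leadingCoeff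
  isPrimitive : P.IsPrimitive
  coeff_zero_ne : P.coeff 0 ≠ 0
  nodup_roots : (P.aroots ℂ).Nodup
  exists_expanding : ∀ Q : ℤ[X], Irreducible Q → Q ∣ P → ∃ α ∈ complexRoots Q, 1 < ‖α‖

/-- `P` is hyperbolic if it has no complex root of modulus `1`. -/
def Hyperbolic (P : ℤ[X]) : Prop := ∀ α ∈ complexRoots P, ‖α‖ ≠ 1

/-- The families `g = (g_α)` of complex polynomials of degree at most `k`, indexed by the expanding
roots `α` of `P`, such that the polynomial attached to the conjugate of `α` is the
(coefficientwise) conjugate of `g_α`. For a real root `α` this says that `g_α` has real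
coefficients. (Values of `g` at other points of `ℂ` play no role.) -/
def Xi (k : ℕ) (P : ℤ[X]) : Set (ℂ → ℂ[X]) :=
  {g | ∀ α ∈ expandingRoots P, (g α).natDegree ≤ k ∧
    g (starRingEnd ℂ α) = (g α).map (starRingEnd ℂ)}

/-- The linear recurrence `x_n(g) = ∑ g_α(n) α ^ n`, the sum being over the expanding roots of `P`.
The sum is a real number when `g ∈ Xi k P`. -/
def recSeq (P : ℤ[X]) (g : ℂ → ℂ[X]) (n : ℤ) : ℝ :=
  (∑ α ∈ expandingRoots P, (g α).eval (n : ℂ) * α ^ n).re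

/-- The distance from a real number to the nearest integer. -/
def distInt (x : ℝ) : ℝ := |x - round x|

/-- The multiplicative Markoff-Lagrange spectrum `L^{(k)}(P)`. -/
def spectrum (k : ℕ) (P : ℤ[X]) : Set ℝ :=
  {y | ∃ g ∈ Xi k P, y = limsup (fun n : ℕ => distInt (recSeq P g (n : ℤ))) atTop}

/-- `ρ_n = -1/(2πi) ∫_{|z| = 1 + 0} z ^ (n - 1) / f(z) dz`: the integral is over the positively
oriented circle `|z| = R` in the limit `R ↓ 1` (it does not depend on `R > 1` close to `1`). -/
def rho (f : ℤ[X]) (n : ℤ) : ℂ :=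
  -1 / (2 * (Real.pi : ℂ) * Complex.I) *
    limUnder (𝓝[>] (1 : ℝ)) fun R : ℝ => ∮ z in C(0, R), z ^ (n - 1) / aeval z f

/-- The moduli `|α|` of the expanding roots. -/
def expandingModuli (P : ℤ[X]) : Set ℝ := {r | ∃ α ∈ expandingRoots P, r = ‖α‖}

/-- The inverse moduli `|α|⁻¹` of the non-expanding roots. -/
def nonexpandingInvModuli (P : ℤ[X]) : Set ℝ := {r | ∃ α ∈ nonexpandingRoots P, r = ‖α‖⁻¹}

/-- `β₁`, the least modulus of an expanding root. -/
def beta₁ (P : ℤ[X]) : ℝ := sInf (expandingModuli P)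

/-- `β₂`, the least inverse modulus of a non-expanding root (only meaningful when there are
non-expanding roots). -/
def beta₂ (P : ℤ[X]) : ℝ := sInf (nonexpandingInvModuli P)

/-- `β = min {β₁, β₂}`, where `β₂ = +∞` (so that `β = β₁`) when there is no non-expanding root;
that is, the least element of the union of the two finite sets over which `β₁` and `β₂` are
minima. -/
def beta (P : ℤ[X]) : ℝ := sInf (expandingModuli P ∪ nonexpandingInvModuli P)

end MarkoffLagrange

end

/-!
By residues, `ρ_n` is a sum of powers of the expanding roots for `n ≤ 0` and of the nonexpanding
roots for `n > 0`, and up to an integer sequence it belongs to the family `x_n(g)`. Hence, modulo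
the integers, the convolution `∑ ρ (n - j) t_j` of `ρ` with a bounded integer sequence `t` starting
at `0` is itself of the form `x_n(g)` with constant `g`. Repeating longer and longer blocks of a
two-sided integer sequence `s` makes the upper limit of the distances to the integers equal to
their supremum for `s`.

Suppose that one real root dominates `ρ` at one of the two ends, and that `M` is the rounded up
half of `β - 1`. Then the values of `ρ` decrease there by a factor less than `2 M + 1`, so that
every small number has an expansion in far values of `ρ` with the digits `-M, …, M`. One
exceptional digit together with such an expansion produces the distance `1 / 2`; a change of far
digits lowers it continuously, and since digits act geometrically, it lowers the distance at least
as much at all the other places where it was `1 / 2`. This fills an interval ending at `1 / 2`.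

For the accumulation point, take `u / (2u + 1)` times the impulse response of `P`, with `2u + 1`
coprime to `P(0)`: modulo the integers it is periodic, the maximal distance is `u / (2u + 1)`, and
the nonexpanding roots contribute an error that vanishes in the limit.
-/

namespace MarkoffLagrange

section DistInt

lemma distInt_eq_norm (x : ℝ) : distInt x = ‖(x : UnitAddCircle)‖ :=
  UnitAddCircle.norm_eq.symm

lemma distInt_le_half (x : ℝ) : distInt x ≤ 1 / 2 := abs_sub_round x

lemma distInt_le_abs (x : ℝ) : distInt x ≤ |x| := by
  simpa [distInt] using round_le x 0

lemma distInt_add_intCast (x : ℝ) (k : ℤ) : distInt (x + k) = distInt x := by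
  simp [distInt]

lemma distInt_le_add (x y : ℝ) : distInt x ≤ distInt y + |x - y| := by
  have h := norm_add_le (y : UnitAddCircle) ((x - y : ℝ) : UnitAddCircle)
  rw [← AddCircle.coe_add, add_sub_cancel, ← distInt_eq_norm, ← distInt_eq_norm,
    ← distInt_eq_norm] at h
  exact h.trans (by gcongr; exact distInt_le_abs _)

lemma distInt_eq_abs {x : ℝ} (hx : |x| ≤ 1 / 2) : distInt x = |x| := by
  rw [distInt_eq_norm, AddCircle.norm_coe_eq_abs_iff _ one_ne_zero]
  simpa using hx

lemma distInt_half_add {δ : ℝ} (hδ : |δ| ≤ 1 / 2) : distInt (1 / 2 + δ) = 1 / 2 - |δ| := by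
  obtain ⟨h₁, h₂⟩ := abs_le.1 hδ
  rcases le_total δ 0 with h | h
  · rw [distInt_eq_abs (abs_le.2 ⟨by linarith, by linarith⟩), abs_of_nonpos h,
      abs_of_nonneg (by linarith), sub_neg_eq_add]
  · rw [← distInt_add_intCast _ (-1), distInt_eq_abs] <;> push_cast
    · rw [abs_of_nonneg h, abs_of_nonpos (by linarith)]
      ring
    · exact abs_le.2 ⟨by linarith, by linarith⟩

lemma distInt_add_of_eq_half {x δ : ℝ} (hx : distInt x = 1 / 2) (hδ : |δ| ≤ 1 / 2) :
    distInt (x + δ) = 1 / 2 - |δ| := by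
  obtain ⟨k, rfl⟩ : ∃ k : ℤ, x = 1 / 2 + k := by
    rcases (abs_eq (by norm_num)).1 hx with h | h
    · exact ⟨round x, by linarith⟩
    · exact ⟨round x - 1, by push_cast; linarith⟩
  rw [add_right_comm, distInt_add_intCast, distInt_half_add hδ]

end DistInt

section Kakeya

lemma exists_int_abs_sub_le {M : ℤ} (hM : 0 ≤ M) (w : ℝ) :
    ∃ t : ℤ, |t| ≤ M ∧ |w - t| ≤ max (1 / 2) (|w| - M) := by
  rcases le_or_gt |w| M with hw | hw
  · refine ⟨round w, ?_, le_max_of_le_left (abs_sub_round w)⟩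
    have h : |(round w : ℝ)| < M + 1 := by
      have := abs_sub_abs_le_abs_sub (round w : ℝ) w
      rw [abs_sub_comm] at this
      linarith [abs_sub_round w]
    exact Int.lt_add_one_iff.1 (by exact_mod_cast h)
  · rcases abs_cases w with ⟨hw', -⟩ | ⟨hw', -⟩ <;> rw [hw'] at hw ⊢
    · exact ⟨M, (abs_of_nonneg hM).le, le_max_of_le_right (abs_of_pos (by linarith)).le⟩
    · refine ⟨-M, by rw [abs_neg, abs_of_nonneg hM], le_max_of_le_right ?_⟩
      push_cast
      rw [abs_of_neg (by linarith)]
      linarith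

lemma exists_digit {M : ℤ} (hM : 0 ≤ M) {u y R : ℝ} (hu : |u| ≤ 2 * R)
    (hy : |y| ≤ M * |u| + R) : ∃ t : ℤ, |t| ≤ M ∧ |y - u * t| ≤ R := by
  rcases eq_or_ne u 0 with rfl | hu₀
  · exact ⟨0, by simpa using hM, by simpa using hy⟩
  obtain ⟨t, htM, ht⟩ := exists_int_abs_sub_le hM (y / u)
  refine ⟨t, htM, ?_⟩
  calc |y - u * t| = |u| * |y / u - t| := by
        rw [← abs_mul, mul_sub, mul_div_cancel₀ _ hu₀]
    _ ≤ |u| * max (1 / 2) (|y / u| - M) := by gcongr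
    _ = max (|u| / 2) (|y| - M * |u|) := by
        rw [mul_max_of_nonneg _ _ (abs_nonneg u), mul_sub, ← abs_mul, mul_div_cancel₀ _ hu₀,
          mul_comm |u| (M : ℝ), mul_one_div]
    _ ≤ R := max_le (by linarith) (by linarith)

/-- The greedy expansion: `R i` bounds the remainder that is left before the digit `i`. -/
lemma exists_tendsto_sum_digits {M : ℤ} (hM : 0 ≤ M) {u R : ℕ → ℝ}
    (hu : ∀ i, |u i| ≤ 2 * R (i + 1)) (hR : ∀ i, R i ≤ M * |u i| + R (i + 1))
    (hR₀ : Tendsto R atTop (𝓝 0)) {y : ℝ} (hy : |y| ≤ R 0) :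
    ∃ t : ℕ → ℤ, (∀ i, |t i| ≤ M) ∧
      Tendsto (fun n => ∑ i ∈ Finset.range n, u i * t i) atTop (𝓝 y) := by
  choose d hdM hd using fun i (z : {z : ℝ // |z| ≤ R i}) =>
    exists_digit hM (hu i) (z.2.trans (hR i))
  let z : (i : ℕ) → {z : ℝ // |z| ≤ R i} := fun i =>
    i.rec ⟨y, hy⟩ fun i z => ⟨z.1 - u i * d i z, hd i z⟩
  have hsum : ∀ n, ∑ i ∈ Finset.range n, u i * (d i (z i) : ℝ) = y - (z n).1 := by
    intro n
    induction n with
    | zero => simp [z]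
    | succ n ih =>
      have hz : (z (n + 1)).1 = (z n).1 - u n * d n (z n) := rfl
      rw [Finset.sum_range_succ, ih, hz]
      ring
  refine ⟨fun i => d i (z i), fun i => hdM i _, ?_⟩
  simp_rw [hsum]
  simpa using (squeeze_zero_norm (f := fun i => (z i).1) (fun i => (z i).2) hR₀).const_sub y

lemma le_mul_tsum_succ {v : ℕ → ℝ} (hv : Summable v) {c : ℝ}
    (h : ∀ i, v i ≤ (c + 1) * v (i + 1)) : v 0 ≤ c * ∑' i, v (i + 1) := by
  have hv' : Summable fun i => v (i + 1) := (summable_nat_add_iff 1).2 hv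
  have hle := hv.tsum_le_tsum h (hv'.mul_left _)
  rw [tsum_mul_left, hv.tsum_eq_zero_add] at hle
  linarith

/-- Kakeya's theorem for the digits `-M, …, M`. -/
lemma exists_hasSum_digits {M : ℤ} (hM : 0 ≤ M) {u : ℕ → ℝ} (hu : Summable u)
    (hratio : ∀ i, |u i| ≤ (2 * M + 1) * |u (i + 1)|) {y : ℝ} (hy : |y| ≤ M * ∑' i, |u i|) :
    ∃ t : ℕ → ℤ, (∀ i, |t i| ≤ M) ∧ HasSum (fun i => u i * t i) y := by
  have hsum : ∀ i, Summable fun k => |u (k + i)| := fun i => (summable_nat_add_iff i).2 hu.abs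
  have hkakeya : ∀ i, |u i| ≤ 2 * (M * ∑' k, |u (k + (i + 1))|) := fun i => by
    have := le_mul_tsum_succ (c := 2 * M) (hsum i) fun k => by
      rw [add_right_comm]
      exact hratio (k + i)
    simpa only [zero_add, add_right_comm _ 1 i, add_assoc, mul_assoc] using this
  have hsucc : ∀ i, M * ∑' k, |u (k + i)| ≤ M * |u i| + M * ∑' k, |u (k + (i + 1))| := fun i => by
    rw [(hsum i).tsum_eq_zero_add, mul_add, zero_add]
    simp only [add_assoc, add_comm 1, le_refl]
  have htail : Tendsto (fun i => M * ∑' k, |u (k + i)|) atTop (𝓝 0) := by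
    simpa using (tendsto_sum_nat_add fun i => |u i|).const_mul (M : ℝ)
  obtain ⟨t, htM, ht⟩ := exists_tendsto_sum_digits hM hkakeya hsucc htail (by simpa using hy)
  refine ⟨t, htM, (Summable.hasSum_iff_tendsto_nat ?_).2 ht⟩
  refine Summable.of_norm_bounded (hu.abs.mul_right (M : ℝ)) fun i => ?_
  rw [Real.norm_eq_abs, abs_mul]
  gcongr
  exact_mod_cast htM i

end Kakeya

section ShiftSum

/-- The sum of a two-sided integer sequence against the weights `f` moved to the place `n`. With
`f k = ρ (-k)` this is the convolution `∑ ρ (n - j) x_j`. -/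
noncomputable def shiftSum (f : ℤ → ℝ) (x : ℤ → ℤ) (n : ℤ) : ℝ := ∑' k : ℤ, f k * x (n + k)

/-- The absolute sum of the weights from the place `k` on. -/
noncomputable def absTail (f : ℤ → ℝ) (k : ℤ) : ℝ := ∑' i : ℕ, |f (k + i)|

variable {f : ℤ → ℝ} {x y : ℤ → ℤ} {B C N n : ℤ}

lemma abs_single_le (m c j : ℤ) : |(Pi.single m c : ℤ → ℤ) j| ≤ |c| := by
  rw [Pi.single_apply]
  split_ifs <;> simp

lemma abs_indicator_le (hx : ∀ j, |x j| ≤ B) (s : Set ℤ) (j : ℤ) : |s.indicator x j| ≤ B := by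
  by_cases hj : j ∈ s
  · simpa [hj] using hx j
  · simpa [hj] using (abs_nonneg _).trans (hx j)

lemma abs_le_max_of_forall_ne {m : ℤ} (hx : ∀ j ≠ m, |x j| ≤ B) (j : ℤ) :
    |x j| ≤ max |x m| B := by
  rcases eq_or_ne j m with rfl | hj
  · exact le_max_left _ _
  · exact le_max_of_le_right (hx j hj)

lemma shiftSum_neg (f : ℤ → ℝ) (x : ℤ → ℤ) (n : ℤ) :
    shiftSum f x n = shiftSum (fun k => f (-k)) (fun j => x (-j)) (-n) := by
  rw [shiftSum, shiftSum, ← (Equiv.neg ℤ).tsum_eq]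
  simp [add_comm]

lemma shiftSum_single (f : ℤ → ℝ) (m c n : ℤ) :
    shiftSum f (Pi.single m c) n = f (m - n) * c := by
  rw [shiftSum, tsum_eq_single (m - n)]
  · simp
  · intro k hk
    simp [Pi.single_eq_of_ne (show n + k ≠ m by omega)]

lemma summable_mul_shift (hf : Summable f) (hx : ∀ j, |x j| ≤ B) (n : ℤ) :
    Summable fun k => f k * (x (n + k) : ℝ) := by
  refine Summable.of_norm_bounded (hf.abs.mul_right (B : ℝ)) fun k => ?_
  rw [Real.norm_eq_abs, abs_mul]
  gcongr
  exact_mod_cast hx (n + k)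

lemma abs_shiftSum_le (hf : Summable f) (hx : ∀ j, |x j| ≤ B) (n : ℤ) :
    |shiftSum f x n| ≤ B * ∑' k, |f k| := by
  rw [shiftSum, ← Real.norm_eq_abs]
  refine tsum_of_norm_bounded (hf.abs.hasSum.mul_left (B : ℝ)) fun k => ?_
  rw [Real.norm_eq_abs, abs_mul, mul_comm]
  gcongr
  exact_mod_cast hx (n + k)

lemma shiftSum_add (hf : Summable f) (hx : ∀ j, |x j| ≤ B) (hy : ∀ j, |y j| ≤ C) (n : ℤ) :
    shiftSum f (x + y) n = shiftSum f x n + shiftSum f y n := by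
  rw [shiftSum, shiftSum, shiftSum,
    ← (summable_mul_shift hf hx n).tsum_add (summable_mul_shift hf hy n)]
  exact tsum_congr fun k => by rw [Pi.add_apply, Int.cast_add, mul_add]

lemma shiftSum_sub (hf : Summable f) (hx : ∀ j, |x j| ≤ B) (hy : ∀ j, |y j| ≤ C) (n : ℤ) :
    shiftSum f (x - y) n = shiftSum f x n - shiftSum f y n := by
  rw [shiftSum, shiftSum, shiftSum,
    ← (summable_mul_shift hf hx n).tsum_sub (summable_mul_shift hf hy n)]
  exact tsum_congr fun k => by rw [Pi.sub_apply, Int.cast_sub, mul_sub]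

lemma summable_add_nat (hf : Summable f) (k : ℤ) : Summable fun i : ℕ => f (k + i) :=
  hf.comp_injective ((add_right_injective k).comp Nat.cast_injective)

lemma tsum_eq_tsum_nat_of_lt {g : ℤ → ℝ} (hg : ∀ k < N, g k = 0) :
    ∑' k, g k = ∑' i : ℕ, g (N + i) := by
  have hinj : Function.Injective fun i : ℕ => N + (i : ℤ) :=
    (add_right_injective N).comp Nat.cast_injective
  refine (hinj.tsum_eq fun k hk => ?_).symm
  have hNk : N ≤ k := not_lt.1 fun hlt => hk (hg k hlt)
  exact ⟨(k - N).toNat, by simp only; omega⟩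

lemma shiftSum_eq_tsum_nat (hx : ∀ j < N, x j = 0) (n : ℤ) :
    shiftSum f x n = ∑' i : ℕ, f (N - n + i) * x (N + i) := by
  rw [shiftSum, tsum_eq_tsum_nat_of_lt (N := N - n) fun k hk => by simp [hx (n + k) (by omega)]]
  exact tsum_congr fun i => by rw [show n + (N - n + i) = N + i by ring]

lemma abs_shiftSum_le_absTail (hf : Summable f) (hx₀ : ∀ j < N, x j = 0) (hx : ∀ j, |x j| ≤ B)
    (n : ℤ) : |shiftSum f x n| ≤ B * absTail f (N - n) := by
  rw [shiftSum_eq_tsum_nat hx₀, ← Real.norm_eq_abs]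
  refine tsum_of_norm_bounded ((summable_add_nat hf _).abs.hasSum.mul_left (B : ℝ)) fun i => ?_
  rw [Real.norm_eq_abs, abs_mul, mul_comm]
  gcongr
  exact_mod_cast hx (N + i)

/-- If the far weights at `n` are almost `l` times those at `m`, then a far change of the sequence
acts at `n` almost `l` times as at `m`. -/
lemma abs_shiftSum_sub_mul_le (hf : Summable f) (hx₀ : ∀ j < N, x j = 0) (hx : ∀ j, |x j| ≤ B)
    {m : ℤ} {l ω : ℝ}
    (h : ∀ i : ℕ, |f (N - n + i) - l * f (N - m + i)| ≤ ω * |f (N - m + i)|) :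
    |shiftSum f x n - l * shiftSum f x m| ≤ ω * (B * absTail f (N - m)) := by
  have hsum : ∀ k, Summable fun i : ℕ => f (N - k + i) * (x (N + i) : ℝ) := fun k =>
    (summable_add_nat (summable_mul_shift hf hx k) (N - k)).congr fun i => by
      rw [show k + (N - k + i) = N + i by ring]
  rw [shiftSum_eq_tsum_nat hx₀, shiftSum_eq_tsum_nat hx₀, ← tsum_mul_left,
    ← (hsum n).tsum_sub ((hsum m).mul_left l), ← Real.norm_eq_abs]
  refine tsum_of_norm_bounded
    (((summable_add_nat hf (N - m)).abs.hasSum.mul_left (B : ℝ)).mul_left ω) fun i => ?_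
  calc ‖f (N - n + i) * x (N + i) - l * (f (N - m + i) * x (N + i))‖
      = |f (N - n + i) - l * f (N - m + i)| * |(x (N + i) : ℝ)| := by
        rw [Real.norm_eq_abs, ← abs_mul, sub_mul, mul_assoc]
    _ ≤ ω * |f (N - m + i)| * B :=
        mul_le_mul (h i) (by exact_mod_cast hx (N + i)) (abs_nonneg _) ((abs_nonneg _).trans (h i))
    _ = ω * (B * |f (N - m + i)|) := by ring

lemma absTail_eq_add (hf : Summable f) (k : ℤ) : absTail f k = |f k| + absTail f (k + 1) := by
  rw [absTail, (summable_add_nat hf k).abs.tsum_eq_zero_add]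
  simp [absTail, add_assoc, add_comm (1 : ℤ)]

lemma absTail_le_mul (hf : Summable f) {c : ℝ} {k : ℤ}
    (h : ∀ j ≥ k, |f j| ≤ c * |f (j + 1)|) : absTail f k ≤ c * absTail f (k + 1) := by
  rw [absTail, absTail, ← tsum_mul_left]
  refine (summable_add_nat hf k).abs.tsum_le_tsum (fun i => ?_)
    ((summable_add_nat hf (k + 1)).abs.mul_left c)
  rw [add_right_comm]
  exact h _ (by omega)

lemma tendsto_absTail (f : ℤ → ℝ) : Tendsto (absTail f) atTop (𝓝 0) := by
  rw [← Nat.map_cast_int_atTop, tendsto_map'_iff]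
  simpa [absTail, Function.comp_def, add_comm] using tendsto_sum_nat_add fun i : ℕ => |f i|

lemma exists_digits_from (hf : Summable f) {M J : ℤ} (hM : 0 ≤ M)
    (hratio : ∀ k ≥ J, |f k| ≤ (2 * M + 1) * |f (k + 1)|) (hN : J ≤ N - n) (hx : ∀ j, |x j| ≤ B)
    {v : ℝ} (hv : |v - shiftSum f ((Set.Iio N).indicator x) n| ≤ M * absTail f (N - n)) :
    ∃ t : ℤ → ℤ, (∀ j < N, t j = x j) ∧ (∀ j ≥ N, |t j| ≤ M) ∧ shiftSum f t n = v := by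
  obtain ⟨d, hdM, hd⟩ := exists_hasSum_digits hM (summable_add_nat hf (N - n)) (fun i => by
    simpa [add_assoc] using hratio (N - n + i) (by omega)) hv
  let w : ℤ → ℤ := fun j => if j < N then 0 else d (j - N).toNat
  have hw₀ : ∀ j < N, w j = 0 := fun j hj => if_pos hj
  have hwM : ∀ j, |w j| ≤ M := fun j => by
    simp only [w]
    split_ifs
    exacts [by simpa using hM, hdM _]
  refine ⟨(Set.Iio N).indicator x + w, fun j hj => ?_, fun j hj => ?_, ?_⟩
  · simp [Set.mem_Iio.2 hj, hw₀ j hj]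
  · simpa [Set.indicator_of_notMem (show j ∉ Set.Iio N by simpa using hj)] using hwM j
  · rw [shiftSum_add hf (abs_indicator_le hx _) hwM, shiftSum_eq_tsum_nat hw₀]
    simp [w, show ∀ i : ℕ, ¬(i : ℤ) < 0 from fun i => by omega, hd.tsum_eq]

end ShiftSum

section Ratio

variable {f : ℤ → ℝ} {a : ℝ}

lemma eventually_ne_zero_of_tendsto_ratio (hf : Tendsto (fun k => f k / f (k + 1)) atTop (𝓝 a))
    (ha : a ≠ 0) : ∀ᶠ k in atTop, f k ≠ 0 := by
  filter_upwards [hf.eventually_ne ha] with k hk hfk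
  simp [hfk] at hk

lemma eventually_abs_le_mul_succ (hf : Tendsto (fun k => f k / f (k + 1)) atTop (𝓝 a))
    (ha : a ≠ 0) {c : ℝ} (hc : |a| < c) : ∀ᶠ k in atTop, |f k| ≤ c * |f (k + 1)| := by
  filter_upwards [hf.eventually_ne ha, hf.abs.eventually_lt_const hc] with k hne hlt
  have hk : f (k + 1) ≠ 0 := fun h => hne (by simp [h])
  rw [abs_div, div_lt_iff₀ (abs_pos.2 hk)] at hlt
  exact hlt.le

lemma tendsto_div_add_nat (hf : Tendsto (fun k => f k / f (k + 1)) atTop (𝓝 a)) (ha : a ≠ 0)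
    (e : ℕ) : Tendsto (fun k => f k / f (k + e)) atTop (𝓝 (a ^ e)) := by
  have hne := eventually_ne_zero_of_tendsto_ratio hf ha
  induction e with
  | zero =>
    refine tendsto_const_nhds.congr' ?_
    filter_upwards [hne] with k hk
    simp [hk]
  | succ e ih =>
    have hshift : Tendsto (fun k : ℤ => k + e) atTop atTop :=
      tendsto_atTop_add_const_right _ _ tendsto_id
    rw [pow_succ]
    refine (ih.mul (hf.comp hshift)).congr' ?_
    filter_upwards [hshift.eventually hne] with k hk
    simp only [Function.comp_apply, Nat.cast_succ, ← add_assoc]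
    exact div_mul_div_cancel₀ hk

lemma eventually_abs_sub_pow_mul_le (hf : Tendsto (fun k => f k / f (k + 1)) atTop (𝓝 a))
    (ha : a ≠ 0) (e : ℕ) {ω : ℝ} (hω : 0 < ω) :
    ∀ᶠ k in atTop, |f k - a ^ e * f (k + e)| ≤ ω * |f (k + e)| := by
  have hshift : Tendsto (fun k : ℤ => k + e) atTop atTop :=
      tendsto_atTop_add_const_right _ _ tendsto_id
  filter_upwards [Metric.tendsto_nhds.1 (tendsto_div_add_nat hf ha e) ω hω,
    hshift.eventually (eventually_ne_zero_of_tendsto_ratio hf ha)] with k hdist hk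
  rw [Real.dist_eq, div_sub' hk, abs_div, div_lt_iff₀ (abs_pos.2 hk)] at hdist
  rw [mul_comm (a ^ e)]
  exact hdist.le

end Ratio

lemma exists_abs_eq_of_abs_le {T R z : ℝ} (hT : |T| ≤ R) (hz₀ : 0 ≤ z) (hz : z ≤ R) :
    ∃ w, |w| = z ∧ |T + w| ≤ R := by
  obtain ⟨h₁, h₂⟩ := abs_le.1 hT
  rcases le_total 0 T with h | h
  · exact ⟨-z, by rw [abs_neg, abs_of_nonneg hz₀], abs_le.2 ⟨by linarith, by linarith⟩⟩
  · exact ⟨z, abs_of_nonneg hz₀, abs_le.2 ⟨by linarith, by linarith⟩⟩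

lemma tendsto_mul_absTail_sub (f : ℤ → ℝ) (c : ℝ) (n : ℤ) :
    Tendsto (fun N : ℤ => c * absTail f (N - n)) atTop (𝓝 0) := by
  simpa [Function.comp_def, sub_eq_add_neg] using ((tendsto_absTail f).comp
    (tendsto_atTop_add_const_right _ (-n) tendsto_id)).const_mul c

lemma eventually_abs_shiftSum_le {f : ℤ → ℝ} (hf : Summable f) (B n : ℤ) {ε : ℝ} (hε : 0 < ε) :
    ∀ᶠ N in atTop, ∀ x : ℤ → ℤ, (∀ j < N, x j = 0) → (∀ j, |x j| ≤ B) →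
      |shiftSum f x n| ≤ ε := by
  filter_upwards [(tendsto_mul_absTail_sub f B n).eventually_le_const hε] with N hN x hx₀ hx
  exact (abs_shiftSum_le_absTail hf hx₀ hx n).trans hN

/-- Summable weights `f` that decay geometrically at `+∞` with the ratio `a⁻¹`, slowly enough for
the digits `-M, …, M` to expand every small number along far weights (Kakeya's condition), while
the sums of all the weights with these digits stay away from `1 / 2`. -/
structure DigitKernel (f : ℤ → ℝ) (M : ℤ) (a : ℝ) : Prop where
  summable : Summable f
  tendsto_ratio : Tendsto (fun k => f k / f (k + 1)) atTop (𝓝 a)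
  one_lt : 1 < |a|
  lt_digits : |a| < 2 * M + 1
  lt_half : M * ∑' k, |f k| < 1 / 2

namespace DigitKernel

variable {f : ℤ → ℝ} {M B : ℤ} {a : ℝ} {x : ℤ → ℤ}

lemma ne_zero (h : DigitKernel f M a) : a ≠ 0 := abs_pos.1 (one_pos.trans h.one_lt)

lemma digits_nonneg (h : DigitKernel f M a) : 0 ≤ M := by
  have : (0 : ℝ) < M := by linarith [h.one_lt, h.lt_digits]
  exact_mod_cast this.le

lemma exists_abs_le_mul_succ (h : DigitKernel f M a) :
    ∃ J, ∀ k ≥ J, |f k| ≤ (2 * M + 1) * |f (k + 1)| :=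
  eventually_atTop.1 (eventually_abs_le_mul_succ h.tendsto_ratio h.ne_zero h.lt_digits)

/-- One integer of arbitrary size at a far place `m` brings the sum close enough to `1 / 2` for the
later digits to correct it. -/
lemma exists_shiftSum_eq_half (h : DigitKernel f M a) :
    ∃ (m : ℤ) (s : ℤ → ℤ), (∀ j ≠ m, |s j| ≤ M) ∧ shiftSum f s 0 = 1 / 2 := by
  obtain ⟨J₁, hJ₁⟩ := h.exists_abs_le_mul_succ
  obtain ⟨J, hJ, hfJ⟩ := ((eventually_ge_atTop J₁).and
    (eventually_ne_zero_of_tendsto_ratio h.tendsto_ratio h.ne_zero)).exists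
  set c := round (1 / 2 / f J)
  have hhead : (Set.Iio (J + 1)).indicator (Pi.single J c : ℤ → ℤ) = Pi.single J c :=
    Set.indicator_eq_self.2 fun j hj => by
      rw [Function.mem_support, Ne, Pi.single_apply] at hj
      simp only [Set.mem_Iio]
      split_ifs at hj <;> omega
  have hround : |1 / 2 - f J * c| ≤ |f J| / 2 := by
    rw [show 1 / 2 - f J * c = f J * (1 / 2 / f J - c) by field_simp, abs_mul]
    linarith [mul_le_mul_of_nonneg_left (abs_sub_round (1 / 2 / f J)) (abs_nonneg (f J))]
  have hkakeya := absTail_le_mul h.summable fun j hj => hJ₁ j (le_trans hJ hj)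
  rw [absTail_eq_add h.summable] at hkakeya
  obtain ⟨s, hsJ, hsM, hs⟩ := exists_digits_from (n := 0) (N := J + 1) (v := 1 / 2) h.summable
    h.digits_nonneg hJ₁ (by omega) (abs_single_le J c) (by
      rw [hhead, shiftSum_single, sub_zero, sub_zero]
      linarith)
  refine ⟨J, s, fun j hj => ?_, hs⟩
  rcases lt_or_ge j (J + 1) with hlt | hge
  · simpa [hsJ j hlt, hj] using h.digits_nonneg
  · exact hsM j hge

lemma exists_abs_shiftSum_le (h : DigitKernel f M a) (m c : ℤ) :
    ∃ v < (1 / 2 : ℝ), M * ∑' k, |f k| ≤ v ∧ ∃ F : Finset ℤ, ∀ n ∉ F, ∀ s : ℤ → ℤ,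
      s m = c → (∀ j ≠ m, |s j| ≤ M) → |shiftSum f s n| ≤ v := by
  obtain ⟨v, hlt, hv⟩ := exists_between h.lt_half
  have hsmall : ∀ᶠ n in cofinite, |f (m - n) * c| < v - M * ∑' k, |f k| := by
    have hinj : Function.Injective fun n : ℤ => m - n := sub_right_injective
    refine Tendsto.eventually_lt_const (sub_pos.2 hlt) ?_
    simpa using
      ((h.summable.tendsto_cofinite_zero.comp hinj.tendsto_cofinite).mul_const (c : ℝ)).abs
  refine ⟨v, hv, hlt.le, (eventually_cofinite.1 hsmall).toFinset, fun n hn s hsm hs => ?_⟩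
  simp only [Set.Finite.mem_toFinset, Set.mem_ofPred_eq, not_not] at hn
  have hupdate : ∀ j, |Function.update s m 0 j| ≤ M := fun j => by
    rcases eq_or_ne j m with rfl | hj
    · simpa using h.digits_nonneg
    · simpa [hj] using hs j hj
  have hsplit : s = Function.update s m 0 + Pi.single m c := by
    ext j
    rcases eq_or_ne j m with rfl | hj
    · simp [hsm]
    · simp [hj]
  rw [hsplit, shiftSum_add h.summable hupdate (abs_single_le m c), shiftSum_single]
  linarith [abs_add_le (shiftSum f (Function.update s m 0) n) (f (m - n) * c),
    abs_shiftSum_le h.summable hupdate n]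

lemma eventually_exists_tail_change (h : DigitKernel f M a) (n : ℤ) :
    ∀ᶠ N in atTop, ∀ x : ℤ → ℤ, (∀ j, |x j| ≤ B) → (∀ j ≥ N, |x j| ≤ M) →
      ∀ z, 0 ≤ z → z ≤ M * absTail f (N - n) → ∃ t : ℤ → ℤ, (∀ j < N, t j = x j) ∧
        (∀ j ≥ N, |t j| ≤ M) ∧ |shiftSum f t n - shiftSum f x n| = z := by
  obtain ⟨J, hJ⟩ := h.exists_abs_le_mul_succ
  filter_upwards [eventually_ge_atTop (J + n)] with N hN x hx hxM z hz₀ hz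
  have htail : ∀ j, |(Set.Iio N)ᶜ.indicator x j| ≤ M := fun j => by
    rcases lt_or_ge j N with hj | hj
    · simpa [hj] using h.digits_nonneg
    · simpa [hj] using hxM j hj
  have hsplit := shiftSum_add h.summable (abs_indicator_le hx (Set.Iio N)) htail n
  rw [Set.indicator_self_add_compl] at hsplit
  obtain ⟨w, hw, hTw⟩ := exists_abs_eq_of_abs_le
    (abs_shiftSum_le_absTail h.summable (fun j hj => by simp [hj]) htail n) hz₀ hz
  obtain ⟨t, htx, htM, ht⟩ := exists_digits_from (v := shiftSum f x n + w) h.summable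
    h.digits_nonneg hJ (show J ≤ N - n by omega) hx (by
      rw [hsplit]
      convert hTw using 2
      ring)
  exact ⟨t, htx, htM, by rw [ht, add_sub_cancel_left, hw]⟩

/-- A far change of the digits is felt at `n > m` about `a ^ (n - m)` times as much as at `m`. The
lower bound on the effect at `m` absorbs the error in the ratio of the weights. -/
lemma eventually_abs_shiftSum_le_abs_shiftSum (h : DigitKernel f M a) {m n : ℤ} (hmn : m ≤ n) :
    ∀ᶠ N in atTop, ∀ x : ℤ → ℤ, (∀ j < N, x j = 0) → (∀ j, |x j| ≤ 2 * M) →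
      M * absTail f (N + 1 - m) ≤ |shiftSum f x m| → |shiftSum f x m| ≤ |shiftSum f x n| := by
  obtain ⟨e, rfl⟩ := Int.le.dest hmn
  rcases Nat.eq_zero_or_pos e with rfl | he
  · simp
  have hM : (0 : ℝ) ≤ M := by exact_mod_cast h.digits_nonneg
  set ω := (|a| - 1) / (2 * (2 * M + 1)) with hω
  have hω₀ : 0 < ω := div_pos (sub_pos.2 h.one_lt) (by positivity)
  obtain ⟨J₁, hJ₁⟩ := h.exists_abs_le_mul_succ
  obtain ⟨J₂, hJ₂⟩ := eventually_atTop.1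
    (eventually_abs_sub_pow_mul_le h.tendsto_ratio h.ne_zero e hω₀)
  filter_upwards [eventually_ge_atTop (J₁ + m), eventually_ge_atTop (J₂ + (m + e))]
    with N hN₁ hN₂ x hx₀ hx hlarge
  set D := |shiftSum f x m|
  have htail : absTail f (N - m) ≤ (2 * M + 1) * absTail f (N + 1 - m) := by
    have := absTail_le_mul (k := N - m) h.summable fun j hj => hJ₁ j (by omega)
    rwa [sub_add_eq_add_sub] at this
  have hdiff := abs_shiftSum_sub_mul_le (n := m + e) (m := m) (l := a ^ e) (ω := ω) h.summable hx₀
    hx fun i => by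
      have := hJ₂ (N - (m + e) + i) (by omega)
      rwa [show N - (m + e) + i + (e : ℤ) = N - m + i by ring] at this
  have herror : ω * (((2 * M : ℤ) : ℝ) * absTail f (N - m)) ≤ (|a| - 1) * D :=
    calc ω * (((2 * M : ℤ) : ℝ) * absTail f (N - m))
        ≤ ω * (2 * M * ((2 * M + 1) * absTail f (N + 1 - m))) := by
          push_cast
          gcongr
      _ = (|a| - 1) * (M * absTail f (N + 1 - m)) := by
          rw [hω]
          field_simp
      _ ≤ (|a| - 1) * D := mul_le_mul_of_nonneg_left hlarge (sub_nonneg.2 h.one_lt.le)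
  have hpow : |a| * D ≤ |a ^ e * shiftSum f x m| := by
    rw [abs_mul, abs_pow]
    exact mul_le_mul_of_nonneg_right (le_self_pow₀ h.one_lt.le he.ne') (abs_nonneg _)
  have htri := abs_sub_abs_le_abs_sub (a ^ e * shiftSum f x m) (shiftSum f x (m + e))
  rw [abs_sub_comm (a ^ e * _)] at htri
  linarith

end DigitKernel

lemma exists_forall_le_sub_of_lt {ι : Type*} (F : Finset ι) (φ : ι → ℝ) (b : ℝ) :
    ∃ η > 0, ∀ i ∈ F, φ i < b → φ i ≤ b - η := by
  induction F using Finset.cons_induction with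
  | empty => exact ⟨1, one_pos, by simp⟩
  | cons i F hi ih =>
    obtain ⟨η, hη, hF⟩ := ih
    rcases lt_or_ge (φ i) b with hlt | hge
    · refine ⟨min η (b - φ i), lt_min hη (sub_pos.2 hlt), fun j hj hjb => ?_⟩
      rcases Finset.mem_cons.1 hj with rfl | hj
      · linarith [min_le_right η (b - φ j)]
      · linarith [min_le_left η (b - φ i), hF j hj hjb]
    · refine ⟨η, hη, fun j hj hjb => ?_⟩
      rcases Finset.mem_cons.1 hj with rfl | hj
      · exact absurd hjb hge.not_gt
      · exact hF j hj hjb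

lemma exists_le_lt_succ_of_tendsto_zero {R : ℤ → ℝ} (hR : Tendsto R atTop (𝓝 0)) {N₀ : ℤ} {z : ℝ}
    (hz₀ : 0 < z) (hz : z ≤ R N₀) : ∃ N ≥ N₀, z ≤ R N ∧ R (N + 1) < z := by
  by_contra! h
  have hle : ∀ N ≥ N₀, z ≤ R N := fun N hN => by
    induction N, hN using Int.leInduction with
    | base => exact hz
    | succ N hN ih => exact h N hN ih
  exact absurd (ge_of_tendsto hR (eventually_atTop.2 ⟨N₀, hle⟩)) hz₀.not_ge

section TailChange

variable {x t : ℤ → ℤ} {B M N : ℤ}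

lemma abs_le_max_of_lt_of_ge (hx : ∀ j, |x j| ≤ B) (htx : ∀ j < N, t j = x j)
    (htM : ∀ j ≥ N, |t j| ≤ M) (j : ℤ) : |t j| ≤ max B M := by
  rcases lt_or_ge j N with hj | hj
  · exact htx j hj ▸ le_max_of_le_left (hx j)
  · exact le_max_of_le_right (htM j hj)

lemma abs_sub_le_two_mul (hM : 0 ≤ M) (htx : ∀ j < N, t j = x j) (htM : ∀ j ≥ N, |t j| ≤ M)
    (hxM : ∀ j ≥ N, |x j| ≤ M) (j : ℤ) : |(t - x) j| ≤ 2 * M := by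
  rcases lt_or_ge j N with hj | hj
  · simpa [htx j hj] using hM
  · rw [two_mul]
    exact (abs_sub _ _).trans (add_le_add (htM j hj) (hxM j hj))

end TailChange

namespace DigitKernel

variable {f : ℤ → ℝ} {M B : ℤ} {a : ℝ} {x : ℤ → ℤ}

lemma eventually_absTail_pos (h : DigitKernel f M a) : ∀ᶠ k in atTop, 0 < absTail f k := by
  filter_upwards [eventually_ne_zero_of_tendsto_ratio h.tendsto_ratio h.ne_zero] with k hk
  rw [absTail_eq_add h.summable]
  exact add_pos_of_pos_of_nonneg (abs_pos.2 hk) (tsum_nonneg fun _ => abs_nonneg _)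

/-- The sum at `m` can be moved by any prescribed small amount, with a smaller effect at no place
of `F` to the right of `m`. -/
lemma exists_perturbation (h : DigitKernel f M a) (F : Finset ℤ) (m : ℤ) {N₀ : ℤ}
    (hx : ∀ j, |x j| ≤ B) (hxM : ∀ j ≥ N₀, |x j| ≤ M) {ε : ℝ} (hε : 0 < ε) :
    ∃ z₀ > 0, ∀ z, 0 < z → z ≤ z₀ → ∃ t : ℤ → ℤ, (∀ j < N₀, t j = x j) ∧
      (∀ j ≥ N₀, |t j| ≤ M) ∧ |shiftSum f t m - shiftSum f x m| = z ∧
      ∀ n ∈ F, |shiftSum f t n - shiftSum f x n| ≤ ε ∧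
        (m ≤ n → z ≤ |shiftSum f t n - shiftSum f x n|) := by
  have hM : (0 : ℝ) < M := by linarith [h.one_lt, h.lt_digits]
  have hshift : Tendsto (fun N : ℤ => N - m) atTop atTop :=
    tendsto_atTop_add_const_right _ (-m) tendsto_id
  obtain ⟨N₁, hN₁⟩ := eventually_atTop.1 <| (eventually_ge_atTop N₀).and <|
    (hshift.eventually h.eventually_absTail_pos).and <|
    (h.eventually_exists_tail_change (B := B) m).and <|
    ((Finset.eventually_all F).2 fun n _ =>
      eventually_abs_shiftSum_le h.summable (2 * M) n hε).and <|
    (Finset.eventually_all {n ∈ F | m ≤ n}).2 fun n hn =>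
      h.eventually_abs_shiftSum_le_abs_shiftSum (Finset.mem_filter.1 hn).2
  refine ⟨M * absTail f (N₁ - m), mul_pos hM (hN₁ N₁ le_rfl).2.1, fun z hz₀ hz => ?_⟩
  obtain ⟨N, hN, hzN, hzN'⟩ :=
    exists_le_lt_succ_of_tendsto_zero (tendsto_mul_absTail_sub f M m) hz₀ hz
  obtain ⟨hN₀, -, hchange, hsmall, hlarge⟩ := hN₁ N hN
  obtain ⟨t, htx, htM, ht⟩ := hchange x hx (fun j hj => hxM j (hN₀.trans hj)) z hz₀.le hzN
  have hdiff₀ : ∀ j < N, (t - x) j = 0 := fun j hj => sub_eq_zero.2 (htx j hj)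
  have hdiff := abs_sub_le_two_mul h.digits_nonneg htx htM fun j hj => hxM j (hN₀.trans hj)
  have hsub : ∀ n, shiftSum f t n - shiftSum f x n = shiftSum f (t - x) n := fun n =>
    (shiftSum_sub h.summable (abs_le_max_of_lt_of_ge hx htx htM) hx n).symm
  rw [hsub] at ht
  refine ⟨t, fun j hj => htx j (hj.trans_le hN₀), fun j hj => ?_, by rw [hsub, ht], fun n hn => ?_⟩
  · rcases lt_or_ge j N with hjN | hjN
    · exact htx j hjN ▸ hxM j hj
    · exact htM j hjN
  · rw [hsub]
    refine ⟨hsmall n hn _ hdiff₀ hdiff, fun hmn => ?_⟩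
    rw [← ht]
    exact hlarge n (Finset.mem_filter.2 ⟨hn, hmn⟩) _ hdiff₀ hdiff (by rw [ht]; exact hzN'.le)

lemma exists_first_distInt_eq_half (h : DigitKernel f M a) :
    ∃ v < (1 / 2 : ℝ), M * ∑' k, |f k| ≤ v ∧ ∃ (m : ℤ) (s : ℤ → ℤ) (F : Finset ℤ) (n₀ : ℤ),
      (∀ j ≠ m, |s j| ≤ M) ∧
      (∀ n ∉ F, ∀ t : ℤ → ℤ, t m = s m → (∀ j ≠ m, |t j| ≤ M) → |shiftSum f t n| ≤ v) ∧
      distInt (shiftSum f s n₀) = 1 / 2 ∧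
      ∀ n, distInt (shiftSum f s n) = 1 / 2 → n ∈ F ∧ n₀ ≤ n := by
  obtain ⟨m, s, hs, hs₀⟩ := h.exists_shiftSum_eq_half
  obtain ⟨v, hv, hMv, F, hF⟩ := h.exists_abs_shiftSum_le m (s m)
  have hmem_F : ∀ n, distInt (shiftSum f s n) = 1 / 2 → n ∈ F := fun n hn => by
    by_contra hnF
    linarith [hF n hnF s rfl hs, distInt_le_abs (shiftSum f s n)]
  have hdist₀ : distInt (shiftSum f s 0) = 1 / 2 := by rw [hs₀, distInt_eq_abs] <;> norm_num
  obtain ⟨n₀, hn₀, hmin⟩ := {n ∈ F | distInt (shiftSum f s n) = 1 / 2}.exists_min_image id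
    ⟨0, Finset.mem_filter.2 ⟨hmem_F 0 hdist₀, hdist₀⟩⟩
  exact ⟨v, hv, hMv, m, s, F, n₀, hs, hF, (Finset.mem_filter.1 hn₀).2, fun n hn =>
    ⟨hmem_F n hn, hmin n (Finset.mem_filter.2 ⟨hmem_F n hn, hn⟩)⟩⟩

/-- Start from a sequence whose sum is at distance `1 / 2` from the integers, first at `n₀` and at
finitely many further places. A far perturbation lowers the distance at `n₀` to the prescribed
value and at the other places at least as much. -/
theorem exists_distInt_eq (h : DigitKernel f M a) : ∃ v < (1 / 2 : ℝ), M * ∑' k, |f k| ≤ v ∧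
    ∀ y ∈ Set.Icc v (1 / 2), ∃ (m : ℤ) (s : ℤ → ℤ), (∀ j ≠ m, |s j| ≤ M) ∧
      (∃ n, distInt (shiftSum f s n) = y) ∧ ∀ n, distInt (shiftSum f s n) ≤ y := by
  obtain ⟨v, hv, hMv, m, s, F, n₀, hs, hF, hn₀, hfirst⟩ := h.exists_first_distInt_eq_half
  obtain ⟨η, hη, hgap⟩ := exists_forall_le_sub_of_lt F (fun n => distInt (shiftSum f s n)) (1 / 2)
  obtain ⟨z₀, hz₀, hpert⟩ := h.exists_perturbation F n₀ (N₀ := m + 1) (ε := min (η / 2) (1 / 2))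
    (abs_le_max_of_forall_ne hs) (fun j hj => hs j (by omega)) (by positivity)
  refine ⟨max v (1 / 2 - z₀), max_lt hv (by linarith), le_max_of_le_left hMv, fun y hy => ?_⟩
  obtain ⟨hvy, hzy⟩ := max_le_iff.1 hy.1
  rcases hy.2.eq_or_lt with rfl | hy₁
  · exact ⟨m, s, hs, ⟨n₀, hn₀⟩, fun n => distInt_le_half _⟩
  obtain ⟨t, htx, htM, htn₀, htF⟩ := hpert (1 / 2 - y) (by linarith) (by linarith)
  have ht : ∀ j ≠ m, |t j| ≤ M := fun j hj => by
    rcases lt_or_ge j (m + 1) with hlt | hge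
    · exact htx j hlt ▸ hs j hj
    · exact htM j hge
  have ht_half : ∀ n, distInt (shiftSum f s n) = 1 / 2 →
      distInt (shiftSum f t n) = 1 / 2 - |shiftSum f t n - shiftSum f s n| := fun n hn => by
    rw [← distInt_add_of_eq_half hn, add_sub_cancel]
    exact (htF n (hfirst n hn).1).1.trans (min_le_right _ _)
  refine ⟨m, t, ht, ⟨n₀, by rw [ht_half n₀ hn₀, htn₀, sub_sub_cancel]⟩, fun n => ?_⟩
  by_cases hn : distInt (shiftSum f s n) = 1 / 2
  · linarith [ht_half n hn, (htF n (hfirst n hn).1).2 (hfirst n hn).2]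
  by_cases hnF : n ∈ F
  · linarith [hgap n hnF (lt_of_le_of_ne (distInt_le_half _) hn), (htF n hnF).1,
      distInt_le_add (shiftSum f t n) (shiftSum f s n), (htF n₀ (hfirst n₀ hn₀).1).1,
      min_le_left (η / 2) (1 / 2)]
  · exact (distInt_le_abs _).trans ((hF n hnF t (htx m (by omega)) ht).trans hvy)

end DigitKernel

lemma limsup_eq_of_forall_pos {ι : Type*} {l : Filter ι} {u : ι → ℝ} {y : ℝ}
    (hle : ∀ δ > 0, ∀ᶠ i in l, u i ≤ y + δ) (hge : ∀ δ > 0, ∃ᶠ i in l, y - δ ≤ u i) :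
    limsup u l = y := by
  have hbdd : IsBoundedUnder (· ≤ ·) l u := isBoundedUnder_of_eventually_le (hle 1 one_pos)
  have hcobdd : IsCoboundedUnder (· ≤ ·) l u := IsCoboundedUnder.of_frequently_ge (hge 1 one_pos)
  refine le_antisymm (le_of_forall_pos_le_add fun δ hδ => limsup_le_of_le hcobdd (hle δ hδ))
    (le_of_forall_pos_le_add fun δ hδ => ?_)
  exact sub_le_iff_le_add.1 (le_limsup_of_frequently_le (hge δ hδ) hbdd)

section Blocks

variable {f : ℤ → ℝ} {s : ℤ → ℤ} {M B : ℤ}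

lemma exists_window (hf : Summable f) (B : ℤ) {δ : ℝ} (hδ : 0 < δ) :
    ∃ L : ℕ, ∀ x y : ℤ → ℤ, (∀ j, |x j| ≤ B) → (∀ j, |y j| ≤ B) → ∀ n p : ℤ,
      (∀ k : ℤ, |k| ≤ L → x (n + k) = y (p + k)) → |shiftSum f x n - shiftSum f y p| ≤ δ := by
  have hlim : Tendsto (fun T : Finset ℤ => ((2 * B : ℤ) : ℝ) * ∑' k : {k // k ∉ T}, |f k|) atTop
      (𝓝 0) := by
    simpa using (tendsto_tsum_compl_atTop_zero fun k => |f k|).const_mul ((2 * B : ℤ) : ℝ)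
  obtain ⟨T, hT⟩ := (hlim.eventually_le_const hδ).exists
  refine ⟨T.sup Int.natAbs, fun x y hx hy n p hxy => le_trans ?_ hT⟩
  have hsum : HasSum ({k | k ∉ T}.indicator fun k => |f k|) (∑' k : {k // k ∉ T}, |f k|) :=
    hasSum_subtype_iff_indicator.1 (hf.abs.subtype _).hasSum
  rw [shiftSum, shiftSum, ← (summable_mul_shift hf hx n).tsum_sub (summable_mul_shift hf hy p),
    ← Real.norm_eq_abs]
  refine tsum_of_norm_bounded (hsum.mul_left _) fun k => ?_
  by_cases hk : k ∈ T
  · have hkL : |k| ≤ (T.sup Int.natAbs : ℕ) := by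
      rw [Int.abs_eq_natAbs]
      exact_mod_cast Finset.le_sup (f := Int.natAbs) hk
    simp [hxy k hkL, hk]
  · have hdiff : |x (n + k) - y (p + k)| ≤ 2 * B := by
      rw [two_mul]
      exact (abs_sub _ _).trans (add_le_add (hx _) (hy _))
    rw [Set.indicator_of_mem (show k ∈ {k | k ∉ T} from hk), ← mul_sub, Real.norm_eq_abs, abs_mul,
      mul_comm]
    gcongr
    exact_mod_cast hdiff

/-- The concatenation of the blocks `s (-k), …, s k` for `k = 0, 1, 2, …`, preceded by zeros. The
middle of the `k`-th block stands at `k ^ 2 + k`. -/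
def blocks (s : ℤ → ℤ) (n : ℤ) : ℤ := if n < 0 then 0 else s (n - n.sqrt ^ 2 - n.sqrt)

lemma blocks_of_neg (s : ℤ → ℤ) {n : ℤ} (hn : n < 0) : blocks s n = 0 := if_pos hn

lemma blocks_apply (s : ℤ → ℤ) {k p : ℤ} (hp : |p| ≤ k) : blocks s (k ^ 2 + k + p) = s p := by
  obtain ⟨h₁, h₂⟩ := abs_le.1 hp
  lift k to ℕ using by omega
  have hsqrt : Int.sqrt (k ^ 2 + k + p) = k := by
    rw [Int.sqrt, Nat.cast_inj, eq_comm, Nat.eq_sqrt]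
    constructor <;> zify <;> rw [Int.toNat_of_nonneg (by nlinarith)] <;> nlinarith
  rw [blocks, if_neg (by nlinarith), hsqrt]
  congr 1
  ring

lemma exists_block {n : ℤ} (hn : 0 ≤ n) : ∃ k p : ℤ, |p| ≤ k ∧ n = k ^ 2 + k + p := by
  lift n to ℕ using hn
  have h₁ := Nat.sqrt_le' n
  have h₂ := Nat.sqrt_le_add n
  zify at h₁ h₂
  exact ⟨n.sqrt, n - n.sqrt ^ 2 - n.sqrt, abs_le.2 ⟨by linarith, by linarith⟩, by ring⟩

lemma abs_blocks_le (hs : ∀ j, |s j| ≤ B) (n : ℤ) : |blocks s n| ≤ B := by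
  rw [blocks]
  split_ifs
  · simpa using (abs_nonneg _).trans (hs 0)
  · exact hs _

/-- Around a far place, `blocks s` looks like `s` or only contains values of `s` at far places. -/
lemma blocks_dichotomy (s : ℤ → ℤ) (K L : ℕ) : ∀ᶠ n in atTop,
    (∃ p : ℤ, ∀ k : ℤ, |k| ≤ L → blocks s (n + k) = s (p + k)) ∨
    ∀ k : ℤ, |k| ≤ L → ∃ p : ℤ, K ≤ |p| ∧ blocks s (n + k) = s p := by
  filter_upwards [eventually_ge_atTop (L + (K + 2 * L + 1) ^ 2 + (K + 2 * L + 1) : ℤ)] with n hn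
  by_cases h : ∃ k p : ℤ, 0 ≤ k ∧ |p| ≤ K + L ∧ n = k ^ 2 + k + p
  · obtain ⟨k, p, hk, hp, rfl⟩ := h
    refine .inl ⟨p, fun j hj => ?_⟩
    have hKL : K + 2 * L ≤ k := by
      by_contra! hlt
      nlinarith [(abs_le.1 hp).2]
    rw [add_assoc (k ^ 2 + k)]
    exact blocks_apply s ((abs_add_le _ _).trans (by linarith))
  · refine .inr fun j hj => ?_
    obtain ⟨k, p, hpk, hp⟩ := exists_block (n := n + j) (by nlinarith [(abs_le.1 hj).1])
    refine ⟨p, ?_, by rw [hp, blocks_apply s hpk]⟩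
    by_contra! hpK
    exact h ⟨k, p - j, (abs_nonneg p).trans hpk, (abs_sub _ _).trans (by linarith), by linarith⟩

lemma frequently_blocks_eq (s : ℤ → ℤ) (p : ℤ) (L : ℕ) :
    ∃ᶠ n in atTop, ∀ k : ℤ, |k| ≤ L → blocks s (n + k) = s (p + k) := by
  refine frequently_atTop.2 fun N => ?_
  set k := |N| + |p| + L with hk
  refine ⟨k ^ 2 + k + p, ?_, fun j hj => ?_⟩
  · have hkp : N ≤ k + p := by linarith [hk, le_abs_self N, neg_le_abs p, Int.natCast_nonneg L]
    linarith [sq_nonneg k]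
  · rw [add_assoc (k ^ 2 + k)]
    exact blocks_apply s ((abs_add_le _ _).trans (by linarith [abs_nonneg N]))

lemma eventually_distInt_blocks_le (hf : Summable f) {m : ℤ} (hs : ∀ j ≠ m, |s j| ≤ M) {y : ℝ}
    (hM : M * ∑' k, |f k| ≤ y) (hle : ∀ n, distInt (shiftSum f s n) ≤ y) {δ : ℝ} (hδ : 0 < δ) :
    ∀ᶠ n in atTop, distInt (shiftSum f (blocks s) n) ≤ y + δ := by
  have hM₀ : 0 ≤ M := (abs_nonneg _).trans (hs (m + 1) (by omega))
  have hs_bdd := abs_le_max_of_forall_ne hs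
  have hblocks := abs_blocks_le hs_bdd
  obtain ⟨L, hL⟩ := exists_window hf (max |s m| M) hδ
  filter_upwards [blocks_dichotomy s (m.natAbs + 1) L] with n hn
  obtain ⟨p, hp⟩ | hfar := hn
  · exact (distInt_le_add _ _).trans
      (add_le_add (hle p) (hL _ _ hblocks hs_bdd n p hp))
  let x := {j | |j - n| ≤ L}.indicator (blocks s)
  have hx : ∀ j, |x j| ≤ M := fun j => by
    by_cases hj : |j - n| ≤ L
    · obtain ⟨p, hp, hxp⟩ := hfar (j - n) hj
      rw [add_sub_cancel] at hxp
      simpa [x, hj, hxp] using hs p (by rintro rfl; rw [Int.abs_eq_natAbs] at hp; omega)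
    · simpa [x, hj] using hM₀
  have hxL := hL _ x hblocks (fun j => le_max_of_le_right (hx j)) n n fun k hk => by simp [x, hk]
  exact (distInt_le_add _ _).trans (add_le_add
    ((distInt_le_abs _).trans ((abs_shiftSum_le hf hx n).trans hM)) hxL)

lemma frequently_le_distInt_blocks (hf : Summable f) (hs : ∀ j, |s j| ≤ B) (p : ℤ) {δ : ℝ}
    (hδ : 0 < δ) :
    ∃ᶠ n in atTop, distInt (shiftSum f s p) - δ ≤ distInt (shiftSum f (blocks s) n) := by
  obtain ⟨L, hL⟩ := exists_window hf B hδ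
  refine (frequently_blocks_eq s p L).mono fun n hn => ?_
  have hclose := hL _ _ hs (abs_blocks_le hs) p n fun k hk => (hn k hk).symm
  linarith [distInt_le_add (shiftSum f s p) (shiftSum f (blocks s) n)]

theorem limsup_distInt_blocks (hf : Summable f) {m : ℤ} (hs : ∀ j ≠ m, |s j| ≤ M) {n₀ : ℤ}
    (hM : M * ∑' k, |f k| ≤ distInt (shiftSum f s n₀))
    (hle : ∀ n, distInt (shiftSum f s n) ≤ distInt (shiftSum f s n₀)) :
    limsup (fun n => distInt (shiftSum f (blocks s) n)) atTop = distInt (shiftSum f s n₀) :=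
  limsup_eq_of_forall_pos (fun _ => eventually_distInt_blocks_le hf hs hM hle) fun _ =>
    frequently_le_distInt_blocks hf (abs_le_max_of_forall_ne hs) n₀

end Blocks

/-- The part of the standing assumptions that the residue calculus for `1 / P` uses: `P` is monic
and nonconstant, with nonzero constant term and simple roots. -/
structure SimpleMonic (P : ℤ[X]) : Prop where
  monic : P.Monic
  natDegree_pos : 0 < P.natDegree
  coeff_zero_ne : P.coeff 0 ≠ 0
  nodup_roots : (P.aroots ℂ).Nodup

section Roots

variable {P : ℤ[X]}

lemma mem_complexRoots (hP : P ≠ 0) {α : ℂ} : α ∈ complexRoots P ↔ aeval α P = 0 := by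
  rw [complexRoots, Multiset.mem_toFinset, mem_aroots, and_iff_right hP]

lemma mem_expandingRoots {α : ℂ} : α ∈ expandingRoots P ↔ α ∈ complexRoots P ∧ 1 < ‖α‖ :=
  Finset.mem_filter

lemma mem_nonexpandingRoots {α : ℂ} :
    α ∈ nonexpandingRoots P ↔ α ∈ complexRoots P ∧ ‖α‖ ≤ 1 :=
  Finset.mem_filter

lemma sum_expandingRoots_add_sum_nonexpandingRoots (P : ℤ[X]) (f : ℂ → ℂ) :
    ∑ α ∈ expandingRoots P, f α + ∑ α ∈ nonexpandingRoots P, f α = ∑ α ∈ complexRoots P, f α := by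
  rw [← Finset.sum_filter_add_sum_filter_not (complexRoots P) fun α => 1 < ‖α‖]
  simp only [not_lt]
  rfl

lemma aeval_conj (Q : ℤ[X]) (α : ℂ) :
    aeval (starRingEnd ℂ α) Q = starRingEnd ℂ (aeval α Q) :=
  aeval_algHom_apply (starRingEnd ℂ).toIntAlgHom α Q

lemma conj_mem_complexRoots (hP : P ≠ 0) {α : ℂ} (h : α ∈ complexRoots P) :
    starRingEnd ℂ α ∈ complexRoots P := by
  rw [mem_complexRoots hP] at h ⊢
  rw [aeval_conj, h, map_zero]

lemma SimpleMonic.ne_zero_of_mem (hP : SimpleMonic P) {α : ℂ} (h : α ∈ complexRoots P) :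
    α ≠ 0 := by
  rintro rfl
  rw [mem_complexRoots hP.monic.ne_zero, ← coeff_zero_eq_aeval_zero'] at h
  exact hP.coeff_zero_ne (by simpa using h)

lemma Hyperbolic.norm_lt_one (hh : Hyperbolic P) {α : ℂ} (h : α ∈ nonexpandingRoots P) :
    ‖α‖ < 1 :=
  lt_of_le_of_ne (mem_nonexpandingRoots.1 h).2 (hh α (mem_nonexpandingRoots.1 h).1)

end Roots

section Residues

variable {P : ℤ[X]}

/-- The residue of `1 / P` at a simple root `α`. -/
noncomputable def residue (P : ℤ[X]) (α : ℂ) : ℂ := (aeval α (derivative P))⁻¹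

lemma residue_conj (P : ℤ[X]) (α : ℂ) :
    residue P (starRingEnd ℂ α) = starRingEnd ℂ (residue P α) := by
  rw [residue, residue, aeval_conj, map_inv₀]

namespace SimpleMonic

lemma nodal_complexRoots (hP : SimpleMonic P) :
    Lagrange.nodal (complexRoots P) id = P.map (algebraMap ℤ ℂ) := by
  rw [(IsAlgClosed.splits (P.map (algebraMap ℤ ℂ))).eq_prod_roots_of_monic (hP.monic.map _),
    Lagrange.nodal, complexRoots, Finset.prod_eq_multiset_prod, Multiset.toFinset_val,
    hP.nodup_roots.dedup]
  rfl

lemma card_complexRoots (hP : SimpleMonic P) : (complexRoots P).card = P.natDegree := by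
  rw [← Lagrange.natDegree_nodal (v := (id : ℂ → ℂ)), hP.nodal_complexRoots,
    hP.monic.natDegree_map]

lemma nodalWeight_eq_residue (hP : SimpleMonic P) {α : ℂ} (h : α ∈ complexRoots P) :
    Lagrange.nodalWeight (complexRoots P) id α = residue P α := by
  rw [Lagrange.nodalWeight_eq_eval_derivative_nodal h, hP.nodal_complexRoots, residue,
    derivative_map, eval_map_algebraMap]
  rfl

lemma residue_ne_zero (hP : SimpleMonic P) {α : ℂ} (h : α ∈ complexRoots P) :
    residue P α ≠ 0 := by
  rw [← hP.nodalWeight_eq_residue h]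
  exact Lagrange.nodalWeight_ne_zero (Set.injOn_id _) h

lemma inv_aeval_eq_sum_residue (hP : SimpleMonic P) {z : ℂ} (hz : z ∉ complexRoots P) :
    (aeval z P)⁻¹ = ∑ α ∈ complexRoots P, residue P α * (z - α)⁻¹ := by
  have hne : (complexRoots P).Nonempty := by
    rw [← Finset.card_pos, hP.card_complexRoots]
    exact hP.natDegree_pos
  have h := Lagrange.eval_interpolate_not_at_node (s := complexRoots P) (v := (id : ℂ → ℂ))
    (1 : ℂ → ℂ) (x := z) fun α hα h => hz (h ▸ hα)
  rw [Lagrange.interpolate_one (Set.injOn_id _) hne, eval_one, hP.nodal_complexRoots,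
    eval_map_algebraMap] at h
  rw [eq_comm, ← mul_eq_one_iff_eq_inv₀ (by rwa [Ne, ← mem_complexRoots hP.monic.ne_zero]),
    mul_comm, h]
  congr 1
  exact Finset.sum_congr rfl fun α hα => by simp [hP.nodalWeight_eq_residue hα]

/-- Euler's formula. -/
lemma sum_residue_mul_aeval (hP : SimpleMonic P) {Q : ℤ[X]} (hQ : Q.degree < P.degree) :
    ∑ α ∈ complexRoots P, residue P α * aeval α Q = (Q.coeff (P.natDegree - 1) : ℂ) := by
  have hdeg : (Q.map (algebraMap ℤ ℂ)).degree < (complexRoots P).card := by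
    rw [hP.card_complexRoots, ← degree_eq_natDegree hP.monic.ne_zero]
    exact degree_map_le.trans_lt hQ
  have h := Lagrange.coeff_eq_sum (s := complexRoots P) (v := (id : ℂ → ℂ)) (Set.injOn_id _) hdeg
  rw [hP.card_complexRoots, coeff_map] at h
  rw [← eq_intCast (algebraMap ℤ ℂ), h]
  refine Finset.sum_congr rfl fun α hα => ?_
  rw [← hP.nodalWeight_eq_residue hα, Lagrange.nodalWeight, Finset.prod_inv_distrib,
    div_eq_mul_inv, mul_comm, id, eval_map_algebraMap]

end SimpleMonic

/-- The impulse response of `P`: the integer solution of the linear recurrence with characteristic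
polynomial `P` and initial values `0, …, 0, 1`. -/
noncomputable def impulse (P : ℤ[X]) (n : ℕ) : ℤ := (X ^ n %ₘ P).coeff (P.natDegree - 1)

lemma SimpleMonic.sum_residue_mul_pow (hP : SimpleMonic P) (n : ℕ) :
    ∑ α ∈ complexRoots P, residue P α * α ^ n = (impulse P n : ℂ) := by
  rw [impulse, ← hP.sum_residue_mul_aeval (degree_modByMonic_lt _ hP.monic)]
  refine Finset.sum_congr rfl fun α hα => ?_
  have h := congrArg (aeval α) (modByMonic_add_div (X ^ n : ℤ[X]) P)
  rw [map_add, map_mul, (mem_complexRoots hP.monic.ne_zero).1 hα, zero_mul, add_zero, map_pow,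
    aeval_X] at h
  rw [h]

end Residues

section CircleIntegral

lemma circleIntegral_zpow {R : ℝ} (hR : R ≠ 0) (n : ℤ) :
    ∮ z in C(0, R), z ^ n = if n = -1 then 2 * Real.pi * Complex.I else 0 := by
  split_ifs with h
  · subst h
    simpa using circleIntegral.integral_sub_center_inv 0 hR
  · simpa using circleIntegral.integral_sub_zpow_of_ne h 0 0 R

lemma sub_ne_zero_of_mem_sphere {α z : ℂ} {R : ℝ} (hα : ‖α‖ ≠ R)
    (hz : z ∈ Metric.sphere (0 : ℂ) R) : z - α ≠ 0 := by
  rw [sub_ne_zero]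
  rintro rfl
  exact hα (by simpa using hz)

lemma circleIntegral_inv_sub {α : ℂ} {R : ℝ} (hR : 0 ≤ R) (hα : ‖α‖ ≠ R) :
    ∮ z in C(0, R), (z - α)⁻¹ = if ‖α‖ < R then 2 * Real.pi * Complex.I else 0 := by
  split_ifs with h
  · exact circleIntegral.integral_sub_inv_of_mem_ball (by simpa using h)
  · have hne : ∀ z ∈ Metric.closedBall (0 : ℂ) R, z - α ≠ 0 := fun z hz h' =>
      hα (le_antisymm (by simpa [sub_eq_zero.1 h'] using hz) (not_lt.1 h))
    refine Complex.circleIntegral_eq_zero_of_differentiable_on_off_countable hR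
      Set.countable_empty ((continuousOn_id.sub continuousOn_const).inv₀ hne) fun z hz => ?_
    exact (differentiableAt_id.sub_const _).inv (hne z (Metric.ball_subset_closedBall hz.1))

lemma circleIntegrable_zpow_mul_inv_sub {α : ℂ} {R : ℝ} (hR : 0 < R) (hα : ‖α‖ ≠ R) (n : ℤ) :
    CircleIntegrable (fun z : ℂ => z ^ n * (z - α)⁻¹) 0 R :=
  ContinuousOn.circleIntegrable hR.le <|
    (continuousOn_id.zpow₀ n fun _ hz => Or.inl (Metric.ne_of_mem_sphere hz hR.ne')).mul
      ((continuousOn_id.sub continuousOn_const).inv₀ fun _ => sub_ne_zero_of_mem_sphere hα)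

lemma circleIntegral_zpow_add_one_mul_inv_sub {α : ℂ} {R : ℝ} (hR : 0 < R) (hα : ‖α‖ ≠ R)
    (n : ℤ) :
    ∮ z in C(0, R), z ^ (n + 1) * (z - α)⁻¹ =
      (if n = -1 then 2 * Real.pi * Complex.I else 0) +
        α * ∮ z in C(0, R), z ^ n * (z - α)⁻¹ := by
  have hz0 : ∀ z ∈ Metric.sphere (0 : ℂ) R, z ≠ 0 := fun z hz =>
    Metric.ne_of_mem_sphere hz hR.ne'
  have hpow : CircleIntegrable (fun z : ℂ => z ^ n) 0 R :=
    ContinuousOn.circleIntegrable hR.le (continuousOn_id.zpow₀ n fun z hz => Or.inl (hz0 z hz))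
  have hint : CircleIntegrable (fun z : ℂ => α * (z ^ n * (z - α)⁻¹)) 0 R :=
    (circleIntegrable_zpow_mul_inv_sub hR hα n).const_fun_smul (a := α)
  rw [← circleIntegral_zpow hR.ne', ← circleIntegral.integral_const_mul,
    ← circleIntegral.integral_add hpow hint]
  refine circleIntegral.integral_congr hR.le fun z hz => ?_
  have := sub_ne_zero_of_mem_sphere hα hz
  simp only [zpow_add_one₀ (hz0 z hz)]
  field_simp
  ring

open Classical in
lemma circleIntegral_zpow_mul_inv_sub {α : ℂ} (hα : α ≠ 0) {R : ℝ} (hR : 0 < R) (hαR : ‖α‖ ≠ R)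
    (n : ℤ) :
    ∮ z in C(0, R), z ^ n * (z - α)⁻¹ =
      2 * Real.pi * Complex.I * ((if ‖α‖ < R then α ^ n else 0) - if n < 0 then α ^ n else 0) := by
  induction n using Int.induction_on with
  | zero => simp [circleIntegral_inv_sub hR.le hαR]
  | succ n ih =>
    rw [circleIntegral_zpow_add_one_mul_inv_sub hR hαR, ih,
      if_neg (show ¬ (n : ℤ) = -1 by omega), if_neg (show ¬ (n : ℤ) < 0 by omega),
      if_neg (show ¬ (n : ℤ) + 1 < 0 by omega), zpow_add_one₀ hα]
    split_ifs <;> ring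
  | pred n ih =>
    have h := circleIntegral_zpow_add_one_mul_inv_sub hR hαR (-n - 1)
    rw [sub_add_cancel, ih, ← sub_eq_iff_eq_add'] at h
    apply mul_left_cancel₀ hα
    rw [← h, if_pos (show -(n : ℤ) - 1 < 0 by omega), zpow_sub_one₀ hα]
    rcases Nat.eq_zero_or_pos n with rfl | hn
    · simp only [Nat.cast_zero, neg_zero, zpow_zero, lt_irrefl, if_false, zero_sub, if_true]
      split_ifs <;> field_simp <;> ring
    · rw [if_pos (show -(n : ℤ) < 0 by omega), if_neg (show ¬ -(n : ℤ) - 1 = -1 by omega)]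
      split_ifs <;> field_simp <;> ring

lemma SimpleMonic.circleIntegral_zpow_div {P : ℤ[X]} (hP : SimpleMonic P) {R : ℝ} (hR : 0 < R)
    (hroots : ∀ α ∈ complexRoots P, ‖α‖ ≠ R) (n : ℤ) :
    ∮ z in C(0, R), z ^ n / aeval z P =
      2 * Real.pi * Complex.I * (∑ α ∈ complexRoots P with ‖α‖ < R, residue P α * α ^ n -
        if n < 0 then ∑ α ∈ complexRoots P, residue P α * α ^ n else 0) := by
  have hfrac : Set.EqOn (fun z : ℂ => z ^ n / aeval z P)
      (fun z => ∑ α ∈ complexRoots P, residue P α * (z ^ n * (z - α)⁻¹))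
      (Metric.sphere 0 R) := fun z hz => by
    have hz : z ∉ complexRoots P := fun h => hroots z h (by simpa using hz)
    simp only [div_eq_mul_inv, hP.inv_aeval_eq_sum_residue hz, Finset.mul_sum, mul_left_comm]
  have hint : ∀ α ∈ complexRoots P,
      CircleIntegrable (fun z : ℂ => residue P α * (z ^ n * (z - α)⁻¹)) 0 R := fun α hα =>
    (circleIntegrable_zpow_mul_inv_sub hR (hroots α hα) n).const_fun_smul (a := residue P α)
  rw [circleIntegral.integral_congr hR.le hfrac, circleIntegral.integral_fun_sum hint,
    Finset.sum_filter, Finset.sum_congr rfl fun α hα => by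
    rw [circleIntegral.integral_const_mul,
      circleIntegral_zpow_mul_inv_sub (hP.ne_zero_of_mem hα) hR (hroots α hα)]]
  split_ifs
  all_goals
    simp only [← Finset.sum_sub_distrib, sub_zero, Finset.mul_sum]
    refine Finset.sum_congr rfl fun α _ => ?_
    split_ifs <;> ring

end CircleIntegral

section Rho

variable {P : ℤ[X]}

lemma eventually_norm_ne_and_lt_iff (S : Finset ℂ) :
    ∀ᶠ R : ℝ in 𝓝[>] 1, ∀ α ∈ S, ‖α‖ ≠ R ∧ (‖α‖ < R ↔ ‖α‖ ≤ 1) := by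
  rw [Finset.eventually_all]
  intro α _
  rcases le_or_gt ‖α‖ 1 with h | h
  · filter_upwards [self_mem_nhdsWithin] with R hR
    have hlt : ‖α‖ < R := lt_of_le_of_lt h hR
    exact ⟨hlt.ne, iff_of_true hlt h⟩
  · filter_upwards [Ioo_mem_nhdsGT h] with R hR
    exact ⟨hR.2.ne', iff_of_false hR.2.not_gt h.not_ge⟩

namespace SimpleMonic

lemma rho_eq (hP : SimpleMonic P) (n : ℤ) :
    rho P n = (if n ≤ 0 then ∑ α ∈ complexRoots P, residue P α * α ^ (n - 1) else 0) -
      ∑ α ∈ nonexpandingRoots P, residue P α * α ^ (n - 1) := by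
  have hev : ∀ᶠ R : ℝ in 𝓝[>] 1, ∮ z in C(0, R), z ^ (n - 1) / aeval z P =
      2 * Real.pi * Complex.I * (∑ α ∈ nonexpandingRoots P, residue P α * α ^ (n - 1) -
        if n - 1 < 0 then ∑ α ∈ complexRoots P, residue P α * α ^ (n - 1) else 0) := by
    filter_upwards [eventually_norm_ne_and_lt_iff (complexRoots P), self_mem_nhdsWithin]
      with R hR hR1
    rw [hP.circleIntegral_zpow_div (one_pos.trans hR1) fun α hα => (hR α hα).1,
      Finset.filter_congr fun α hα => (hR α hα).2, nonexpandingRoots]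
  have hlim := (tendsto_const_nhds.congr' (hev.mono fun _ h => h.symm)).limUnder_eq
  rw [rho, hlim, ← mul_assoc, div_mul_cancel₀ _ Complex.two_pi_I_ne_zero, neg_one_mul, neg_sub]
  simp only [Int.sub_one_lt_iff]

lemma rho_of_nonpos (hP : SimpleMonic P) {n : ℤ} (hn : n ≤ 0) :
    rho P n = ∑ α ∈ expandingRoots P, residue P α * α ^ (n - 1) := by
  rw [hP.rho_eq, if_pos hn, ← sum_expandingRoots_add_sum_nonexpandingRoots, add_sub_cancel_right]

lemma rho_neg (hP : SimpleMonic P) (n : ℕ) :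
    rho P (-n) = ∑ α ∈ expandingRoots P, residue P α * α⁻¹ * α⁻¹ ^ n := by
  rw [hP.rho_of_nonpos (by omega)]
  refine Finset.sum_congr rfl fun α hα => ?_
  rw [zpow_sub_one₀ (hP.ne_zero_of_mem (mem_expandingRoots.1 hα).1), zpow_neg, zpow_natCast,
    inv_pow]
  ring

lemma rho_succ (hP : SimpleMonic P) (n : ℕ) :
    rho P (n + 1) = ∑ α ∈ nonexpandingRoots P, -residue P α * α ^ n := by
  rw [hP.rho_eq, if_neg (by omega), zero_sub]
  simp

lemma rho_eq_sub_impulse (hP : SimpleMonic P) (n : ℤ) :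
    rho P n = ∑ α ∈ expandingRoots P, residue P α * α ^ (n - 1) -
      ((if 0 < n then impulse P (n - 1).toNat else 0 : ℤ) : ℂ) := by
  split_ifs with hn
  · obtain ⟨k, hk⟩ := Int.eq_ofNat_of_zero_le (show 0 ≤ n - 1 by omega)
    rw [show n = k + 1 by omega, hP.rho_succ, add_sub_cancel_right, Int.toNat_natCast,
      ← hP.sum_residue_mul_pow, ← sum_expandingRoots_add_sum_nonexpandingRoots]
    simp
  · rw [hP.rho_of_nonpos (not_lt.1 hn), Int.cast_zero, sub_zero]

lemma summable_norm_rho (hP : SimpleMonic P) (hh : Hyperbolic P) :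
    Summable fun n => ‖rho P n‖ := by
  refine Summable.of_nat_of_neg ?_ ?_
  · rw [← summable_nat_add_iff 1]
    push_cast
    simp_rw [hP.rho_succ]
    refine Summable.norm (summable_sum fun α hα => ?_)
    exact (summable_geometric_of_norm_lt_one (hh.norm_lt_one hα)).mul_left _
  · simp_rw [hP.rho_neg]
    refine Summable.norm (summable_sum fun α hα => Summable.mul_left _ ?_)
    refine summable_geometric_of_norm_lt_one ?_
    rw [norm_inv]
    exact inv_lt_one_of_one_lt₀ (mem_expandingRoots.1 hα).2

lemma summable_re_rho (hP : SimpleMonic P) (hh : Hyperbolic P) :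
    Summable fun n => (rho P n).re :=
  (Complex.hasSum_re (hP.summable_norm_rho hh).of_norm.hasSum).summable

lemma summable_re_rho_neg (hP : SimpleMonic P) (hh : Hyperbolic P) :
    Summable fun n => (rho P (-n)).re :=
  (Equiv.neg ℤ).summable_iff.2 (hP.summable_re_rho hh)

end SimpleMonic

end Rho

section Spectrum

variable {P : ℤ[X]}

lemma limsup_distInt_re_sum_mem_spectrum {c : ℂ → ℂ}
    (hc : ∀ α, c (starRingEnd ℂ α) = starRingEnd ℂ (c α)) :
    limsup (fun n : ℕ => distInt (∑ α ∈ expandingRoots P, c α * α ^ n).re) atTop ∈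
      spectrum 0 P := by
  refine ⟨fun α => C (c α), fun α _ => ⟨(natDegree_C _).le, ?_⟩, ?_⟩
  · simp [hc]
  · simp [recSeq]

lemma hasSum_zpow_sub_mul {t : ℕ → ℤ} {B : ℤ} (ht : ∀ j, |t j| ≤ B) {α : ℂ} (hα : 1 < ‖α‖)
    (n : ℕ) :
    HasSum (fun j : ℕ => α ^ ((n : ℤ) - j - 1) * t j)
      ((∑' j : ℕ, α⁻¹ ^ (j + 1) * t j) * α ^ n) := by
  have hα₀ : α ≠ 0 := norm_pos_iff.1 (one_pos.trans hα)
  have hgeom : Summable fun j : ℕ => ‖α⁻¹‖ ^ (j + 1) :=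
    (summable_nat_add_iff 1).2 (summable_geometric_of_lt_one (norm_nonneg _)
      (by rw [norm_inv]; exact inv_lt_one_of_one_lt₀ hα))
  have hsum : Summable fun j : ℕ => α⁻¹ ^ (j + 1) * (t j : ℂ) := by
    refine Summable.of_norm_bounded (hgeom.mul_right (B : ℝ)) fun j => ?_
    rw [norm_mul, norm_pow, Complex.norm_intCast]
    gcongr
    exact_mod_cast ht j
  refine (hsum.hasSum.mul_right (α ^ n)).congr_fun fun j => ?_
  rw [show (n : ℤ) - j - 1 = n - (j + 1 : ℕ) by push_cast; ring, zpow_sub₀ hα₀, zpow_natCast,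
    zpow_natCast, inv_pow]
  ring

namespace SimpleMonic

lemma exists_hasSum_rho_mul (hP : SimpleMonic P) {t : ℕ → ℤ} {B : ℤ} (ht : ∀ j, |t j| ≤ B)
    (n : ℕ) : ∃ k : ℤ, HasSum (fun j : ℕ => rho P (n - j) * t j)
      (∑ α ∈ expandingRoots P, residue P α * (∑' j : ℕ, α⁻¹ ^ (j + 1) * t j) * α ^ n + k) := by
  let ι : ℕ → ℤ := fun j =>
    (if 0 < (n : ℤ) - j then impulse P ((n : ℤ) - j - 1).toNat else 0) * t j
  have hι : HasSum (fun j => (ι j : ℂ)) ((∑ j ∈ Finset.range n, ι j : ℤ) : ℂ) := by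
    rw [Int.cast_sum]
    refine hasSum_sum_of_ne_finset_zero fun j hj => ?_
    rw [Finset.mem_range] at hj
    simp only [ι]
    rw [if_neg (by omega), zero_mul, Int.cast_zero]
  have hexp : HasSum
      (fun j : ℕ => ∑ α ∈ expandingRoots P, residue P α * (α ^ ((n : ℤ) - j - 1) * t j))
      (∑ α ∈ expandingRoots P, residue P α * ((∑' j : ℕ, α⁻¹ ^ (j + 1) * t j) * α ^ n)) :=
    hasSum_sum fun α hα => (hasSum_zpow_sub_mul ht (mem_expandingRoots.1 hα).2 n).mul_left _
  refine ⟨-∑ j ∈ Finset.range n, ι j, ?_⟩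
  simp only [mul_assoc]
  rw [Int.cast_neg, ← sub_eq_add_neg]
  refine (hexp.sub hι).congr_fun fun j => ?_
  simp only [hP.rho_eq_sub_impulse, ι, sub_mul, Finset.sum_mul, Int.cast_mul, mul_assoc]

theorem limsup_mem_spectrum (hP : SimpleMonic P) {t : ℤ → ℤ} {B : ℤ} (ht₀ : ∀ j < 0, t j = 0)
    (ht : ∀ j, |t j| ≤ B) :
    limsup (fun n : ℤ => distInt (shiftSum (fun k => (rho P (-k)).re) t n)) atTop ∈
      spectrum 0 P := by
  rw [← Nat.map_cast_int_atTop]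
  have hcongr : ∀ n : ℕ, distInt (shiftSum (fun k => (rho P (-k)).re) t n) =
      distInt (∑ α ∈ expandingRoots P,
        residue P α * (∑' j : ℕ, α⁻¹ ^ (j + 1) * t j) * α ^ n).re := by
    intro n
    obtain ⟨k, hk⟩ := hP.exists_hasSum_rho_mul (fun j : ℕ => ht j) n
    have hsum : shiftSum (fun k => (rho P (-k)).re) t n =
        ∑' j : ℕ, (rho P (n - j) * (t j : ℂ)).re := by
      rw [shiftSum_eq_tsum_nat ht₀]
      exact tsum_congr fun j => by simp [sub_eq_add_neg, add_comm]
    rw [hsum, (Complex.hasSum_re hk).tsum_eq, Complex.add_re, Complex.intCast_re,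
      distInt_add_intCast]
  change limsup (fun n : ℕ => distInt (shiftSum (fun k => (rho P (-k)).re) t n)) atTop ∈ _
  simp only [hcongr]
  refine limsup_distInt_re_sum_mem_spectrum fun α => ?_
  simp only [residue_conj, map_mul, Complex.conj_tsum, map_pow, map_inv₀, map_intCast]

/-- Blocks of a two-sided digit sequence with growing radii turn the two-sided maximum into an
upper limit along a one-sided sequence. -/
theorem distInt_shiftSum_mem_spectrum (hP : SimpleMonic P) (hh : Hyperbolic P) {M m n₀ : ℤ}
    {s : ℤ → ℤ} (hs : ∀ j ≠ m, |s j| ≤ M)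
    (hM : M * ∑' k, |(rho P (-k)).re| ≤ distInt (shiftSum (fun k => (rho P (-k)).re) s n₀))
    (hle : ∀ n, distInt (shiftSum (fun k => (rho P (-k)).re) s n) ≤
      distInt (shiftSum (fun k => (rho P (-k)).re) s n₀)) :
    distInt (shiftSum (fun k => (rho P (-k)).re) s n₀) ∈ spectrum 0 P := by
  rw [← limsup_distInt_blocks (hP.summable_re_rho_neg hh) hs hM hle]
  exact hP.limsup_mem_spectrum (fun j => blocks_of_neg s)
    (abs_blocks_le (abs_le_max_of_forall_ne hs))

end SimpleMonic

end Spectrum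

section AccPt

variable {P : ℤ[X]}

lemma frequently_X_pow_modByMonic_eq {R : Type*} [CommRing R] [Finite R] {Q : R[X]} (hQ : Q.Monic)
    (h₀ : IsUnit (Q.coeff 0)) (m : ℕ) : ∃ᶠ n in atTop, X ^ n %ₘ Q = X ^ m %ₘ Q := by
  have := hQ.finite_adjoinRoot
  have : Finite (AdjoinRoot Q) := Module.finite_of_finite R
  obtain ⟨u, hu⟩ : IsUnit (AdjoinRoot.root Q) := by
    have h := congrArg (AdjoinRoot.mk Q) (divX_mul_X_add Q)
    rw [AdjoinRoot.mk_self, map_add, map_mul, AdjoinRoot.mk_X, AdjoinRoot.mk_C,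
      add_eq_zero_iff_eq_neg] at h
    exact isUnit_of_mul_isUnit_right (h ▸ (h₀.map (AdjoinRoot.of Q)).neg)
  refine frequently_atTop.2 fun N => ⟨N * orderOf u + m, ?_, modByMonic_eq_of_dvd_sub hQ ?_⟩
  · exact (Nat.le_mul_of_pos_right N (orderOf_pos u)).trans (Nat.le_add_right _ _)
  · have h : u ^ (N * orderOf u + m) = u ^ m := by
      rw [pow_add, mul_comm N, pow_mul, pow_orderOf_eq_one, one_pow, one_mul]
    rw [← AdjoinRoot.mk_eq_mk, map_pow, map_pow, AdjoinRoot.mk_X, ← hu, ← Units.val_pow_eq_pow_val,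
      ← Units.val_pow_eq_pow_val, h]

lemma frequently_impulse_eq (hP : P.Monic) {q : ℕ} [NeZero q]
    (h₀ : IsUnit (P.coeff 0 : ZMod q)) (m : ℕ) :
    ∃ᶠ n in atTop, (impulse P n : ZMod q) = impulse P m := by
  have hcast : ∀ n, (impulse P n : ZMod q) =
      (X ^ n %ₘ P.map (Int.castRingHom (ZMod q))).coeff (P.natDegree - 1) := fun n => by
    have h : (X ^ n %ₘ P).map (Int.castRingHom (ZMod q)) = X ^ n %ₘ P.map (Int.castRingHom _) := by
      rw [map_modByMonic _ hP, Polynomial.map_pow, map_X]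
    rw [impulse, ← h, coeff_map, eq_intCast]
  refine (frequently_X_pow_modByMonic_eq (hP.map (Int.castRingHom (ZMod q))) ?_ m).mono
    fun n hn => ?_
  · rwa [coeff_map, eq_intCast]
  · rw [hcast, hcast, hn]

lemma SimpleMonic.impulse_natDegree_sub_one (hP : SimpleMonic P) :
    impulse P (P.natDegree - 1) = 1 := by
  rw [impulse, (modByMonic_eq_self_iff hP.monic).2, coeff_X_pow_self]
  rw [degree_X_pow, degree_eq_natDegree hP.monic.ne_zero]
  exact_mod_cast Nat.sub_one_lt hP.natDegree_pos.ne'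

lemma distInt_div_mul_intCast_le (u : ℕ) (k : ℤ) :
    distInt (u / (2 * u + 1) * k) ≤ u / (2 * u + 1) := by
  set r := Int.bmod (u * k) (2 * u + 1) with hr
  have hrk : (r : ℝ) + (2 * u + 1) * Int.bdiv (u * k) (2 * u + 1) = u * k := by
    exact_mod_cast Int.bmod_add_bdiv (u * k) (2 * u + 1)
  have hru : |r| ≤ u := by
    have h₁ := Int.le_bmod (x := u * k) (by omega : 0 < 2 * u + 1)
    have h₂ := Int.bmod_le (x := u * k) (by omega : 0 < 2 * u + 1)
    rw [abs_le, hr]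
    omega
  have hu : (0 : ℝ) < 2 * u + 1 := by positivity
  have hdiv : (u / (2 * u + 1) * k : ℝ) = r / (2 * u + 1) + Int.bdiv (u * k) (2 * u + 1) := by
    field_simp
    linarith
  rw [hdiv, distInt_add_intCast]
  refine (distInt_le_abs _).trans ?_
  rw [abs_div, abs_of_pos hu]
  gcongr
  exact_mod_cast hru

lemma distInt_div_mul_intCast_eq {u : ℕ} {k : ℤ} (hk : (k : ZMod (2 * u + 1)) = 1) :
    distInt (u / (2 * u + 1) * k) = u / (2 * u + 1) := by
  obtain ⟨l, hl⟩ : ((2 * u + 1 : ℕ) : ℤ) ∣ k - 1 := by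
    rw [← ZMod.intCast_zmod_eq_zero_iff_dvd, Int.cast_sub, hk, Int.cast_one, sub_self]
  have hkl : (k : ℝ) = 1 + (2 * u + 1) * l := by
    rw [sub_eq_iff_eq_add'] at hl
    exact_mod_cast hl
  have hle : (u / (2 * u + 1) : ℝ) ≤ 1 / 2 := by
    rw [div_le_div_iff₀ (by positivity) two_pos]
    linarith
  have hshift : (u / (2 * u + 1) * k : ℝ) = u / (2 * u + 1) + (u * l : ℤ) := by
    rw [hkl]
    push_cast
    field_simp
  have habs : |(u / (2 * u + 1) : ℝ)| = u / (2 * u + 1) := abs_of_nonneg (by positivity)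
  rw [hshift, distInt_add_intCast, distInt_eq_abs (habs.trans_le hle), habs]

lemma limsup_distInt_add_eq {x e : ℕ → ℝ} {y : ℝ} (he : Tendsto e atTop (𝓝 0))
    (hle : ∀ n, distInt (x n) ≤ y) (heq : ∃ᶠ n in atTop, distInt (x n) = y) :
    limsup (fun n => distInt (x n + e n)) atTop = y := by
  have hsmall : ∀ δ > 0, ∀ᶠ n in atTop, |e n| ≤ δ := fun δ hδ =>
    (he.abs.eventually_le_const (by rwa [abs_zero]))
  refine limsup_eq_of_forall_pos (fun δ hδ => ?_) fun δ hδ => ?_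
  · filter_upwards [hsmall δ hδ] with n hn
    have h := distInt_le_add (x n + e n) (x n)
    rw [add_sub_cancel_left] at h
    linarith [hle n]
  · refine (heq.and_eventually (hsmall δ hδ)).mono fun n ⟨hn, hen⟩ => ?_
    have h := distInt_le_add (x n) (x n + e n)
    rw [sub_add_cancel_left, abs_neg] at h
    linarith [hn, hen]

namespace SimpleMonic

/-- Modulo the integers the sequence `u / (2u + 1) * impulse P n` is periodic, and differs from an
element of the recurrence family by the vanishing contributions of the nonexpanding roots. -/
theorem div_mem_spectrum_zero (hP : SimpleMonic P) (hh : Hyperbolic P) {u : ℕ}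
    (h₀ : IsUnit (P.coeff 0 : ZMod (2 * u + 1))) : (u / (2 * u + 1) : ℝ) ∈ spectrum 0 P := by
  set κ : ℝ := u / (2 * u + 1)
  let e : ℕ → ℝ := fun n => -(κ * ∑ α ∈ nonexpandingRoots P, residue P α * α ^ n : ℂ).re
  have hdecomp : ∀ n : ℕ, (∑ α ∈ expandingRoots P, κ * residue P α * α ^ n).re =
      κ * impulse P n + e n := fun n => by
    have h := hP.sum_residue_mul_pow n
    rw [← sum_expandingRoots_add_sum_nonexpandingRoots, ← eq_sub_iff_add_eq] at h
    simp only [e, mul_assoc, ← Finset.mul_sum, h, mul_sub, Complex.sub_re, ← sub_eq_add_neg]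
    rw [Complex.re_ofReal_mul κ (impulse P n), Complex.intCast_re]
  have he : Tendsto e atTop (𝓝 0) := by
    have h : Tendsto (fun n : ℕ => (κ * ∑ α ∈ nonexpandingRoots P, residue P α * α ^ n : ℂ)) atTop
        (𝓝 (κ * ∑ α ∈ nonexpandingRoots P, residue P α * 0)) :=
      (tendsto_finsetSum _ fun α hα =>
        (tendsto_pow_atTop_nhds_zero_of_norm_lt_one (hh.norm_lt_one hα)).const_mul _).const_mul _
    simpa [e, Function.comp_def] using ((Complex.continuous_re.tendsto _).comp h).neg
  have hfreq : ∃ᶠ n in atTop, distInt (κ * impulse P n) = κ :=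
    (frequently_impulse_eq hP.monic h₀ (P.natDegree - 1)).mono fun n hn =>
      distInt_div_mul_intCast_eq (by rw [hn, hP.impulse_natDegree_sub_one, Int.cast_one])
  have hlimsup : limsup (fun n => distInt (κ * impulse P n + e n)) atTop = κ :=
    limsup_distInt_add_eq he (fun n => distInt_div_mul_intCast_le u _) hfreq
  rw [← hlimsup]
  simp only [← hdecomp]
  exact limsup_distInt_re_sum_mem_spectrum fun α => by
    rw [residue_conj, map_mul, Complex.conj_ofReal]

theorem accPt_spectrum_zero (hP : SimpleMonic P) (hh : Hyperbolic P) :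
    AccPt (1 / 2 : ℝ) (𝓟 (spectrum 0 P)) := by
  have hlim : Tendsto (fun u : ℕ => (u / (2 * u + 1) : ℝ)) atTop (𝓝 (1 / 2)) := by
    simpa [add_comm] using tendsto_add_mul_div_add_mul_atTop_nhds (0 : ℝ) 1 1 two_ne_zero
  have hmul : Tendsto (fun N => (P.coeff 0).natAbs * N) atTop atTop :=
    tendsto_id.const_mul_atTop' (Int.natAbs_pos.2 hP.coeff_zero_ne)
  refine accPt_iff_frequently.2 ((hlim.comp hmul).frequently (Frequently.of_forall fun N => ?_))
  set u := (P.coeff 0).natAbs * N with hu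
  refine ⟨?_, hP.div_mem_spectrum_zero hh ?_⟩
  · have h : (u / (2 * u + 1) : ℝ) < 1 / 2 := by
      rw [div_lt_div_iff₀ (by positivity) two_pos]
      linarith
    exact h.ne
  · have hcop : IsCoprime (P.coeff 0) ((2 * u + 1 : ℕ) : ℤ) := by
      obtain ⟨c, hc⟩ : P.coeff 0 ∣ (P.coeff 0).natAbs := Int.dvd_natAbs_self
      refine ⟨-(2 * c * N), 1, ?_⟩
      rw [hu, Nat.cast_add, Nat.cast_mul, Nat.cast_mul, hc]
      push_cast
      ring
    simpa using (ZMod.coe_int_isUnit_iff_isCoprime (P.coeff 0) (2 * u + 1)).2 hcop.symm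

end SimpleMonic

lemma spectrum_zero_subset (k : ℕ) (P : ℤ[X]) : spectrum 0 P ⊆ spectrum k P := by
  rintro y ⟨g, hg, rfl⟩
  exact ⟨g, fun α hα => ⟨(hg α hα).1.trans k.zero_le, (hg α hα).2⟩, rfl⟩

theorem SimpleMonic.accPt_spectrum (hP : SimpleMonic P) (hh : Hyperbolic P) (k : ℕ) :
    AccPt (1 / 2 : ℝ) (𝓟 (spectrum k P)) :=
  (hP.accPt_spectrum_zero hh).mono (principal_mono.2 (spectrum_zero_subset k P))

end AccPt

section DominantRoot

variable {P : ℤ[X]}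

lemma conj_mem_expandingRoots (hP : P ≠ 0) {α : ℂ} (h : α ∈ expandingRoots P) :
    starRingEnd ℂ α ∈ expandingRoots P := by
  rw [mem_expandingRoots] at h ⊢
  exact ⟨conj_mem_complexRoots hP h.1, by rw [RCLike.norm_conj]; exact h.2⟩

lemma conj_mem_nonexpandingRoots (hP : P ≠ 0) {α : ℂ} (h : α ∈ nonexpandingRoots P) :
    starRingEnd ℂ α ∈ nonexpandingRoots P := by
  rw [mem_nonexpandingRoots] at h ⊢
  exact ⟨conj_mem_complexRoots hP h.1, by rw [RCLike.norm_conj]; exact h.2⟩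

lemma exists_ofReal_eq_of_conj_mem {S : Finset ℂ} (hS : ∀ α ∈ S, starRingEnd ℂ α ∈ S) {α₀ : ℂ}
    (h₀ : α₀ ∈ S) (h : ∀ α ∈ S, α ≠ α₀ → ‖α‖ ≠ ‖α₀‖) : ∃ r : ℝ, (r : ℂ) = α₀ := by
  refine ⟨α₀.re, Complex.conj_eq_iff_re.1 ?_⟩
  by_contra hne
  exact h _ (hS _ h₀) hne (RCLike.norm_conj α₀)

lemma tendsto_sum_mul_pow {S : Finset ℂ} {c z : ℂ → ℂ} {α₀ u : ℂ} (h₀ : α₀ ∈ S)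
    (hu : z α₀ * u = 1) (hlt : ∀ α ∈ S, α ≠ α₀ → ‖z α * u‖ < 1) :
    Tendsto (fun n : ℕ => (∑ α ∈ S, c α * z α ^ n) * u ^ n) atTop (𝓝 (c α₀)) := by
  have hterm : ∀ α ∈ S, Tendsto (fun n : ℕ => c α * (z α * u) ^ n) atTop
      (𝓝 (if α = α₀ then c α else 0)) := by
    intro α hα
    split_ifs with h
    · simp [h, hu]
    · simpa using (tendsto_pow_atTop_nhds_zero_of_norm_lt_one (hlt α hα h)).const_mul (c α)
  have hsum := tendsto_finsetSum S hterm
  rw [Finset.sum_ite_eq_of_mem' S α₀ _ h₀] at hsum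
  refine hsum.congr fun n => ?_
  simp only [Finset.sum_mul, mul_pow, mul_assoc]

lemma tendsto_re_sum_div_re_sum_succ {S : Finset ℂ} {c z : ℂ → ℂ} {α₀ : ℂ} {a : ℝ} (h₀ : α₀ ∈ S)
    (ha : z α₀ * a = 1) (hc : (c α₀).re ≠ 0) (hlt : ∀ α ∈ S, α ≠ α₀ → ‖z α * a‖ < 1) :
    Tendsto (fun n : ℕ => (∑ α ∈ S, c α * z α ^ n).re / (∑ α ∈ S, c α * z α ^ (n + 1)).re) atTop
      (𝓝 a) := by
  have ha₀ : a ≠ 0 := by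
    rintro rfl
    simp at ha
  have hlim : Tendsto (fun n : ℕ => (∑ α ∈ S, c α * z α ^ n).re * a ^ n) atTop (𝓝 (c α₀).re) := by
    refine ((Complex.continuous_re.tendsto _).comp (tendsto_sum_mul_pow h₀ ha hlt)).congr
      fun n => ?_
    rw [Function.comp_apply, ← Complex.ofReal_pow, Complex.re_mul_ofReal]
  have hratio := (hlim.div ((tendsto_add_atTop_iff_nat 1).2 hlim) hc).mul_const a
  rw [div_self hc, one_mul] at hratio
  refine hratio.congr fun n => ?_
  rw [Pi.div_apply, pow_succ a, ← mul_assoc]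
  field_simp

lemma tendsto_div_succ_of_tendsto_nat {f : ℤ → ℝ} {a : ℝ}
    (h : Tendsto (fun n : ℕ => f n / f (n + 1)) atTop (𝓝 a)) :
    Tendsto (fun k => f k / f (k + 1)) atTop (𝓝 a) := by
  rwa [← Nat.map_cast_int_atTop, tendsto_map'_iff]

end DominantRoot

section IntegerRoots

variable {P : ℤ[X]}

lemma isRoot_of_intCast_mem (hP : P ≠ 0) {b : ℤ} (h : (b : ℂ) ∈ complexRoots P) : P.IsRoot b := by
  have hb : aeval (algebraMap ℤ ℂ b) P = 0 := by simpa using (mem_complexRoots hP).1 h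
  rw [aeval_algebraMap_apply_eq_algebraMap_eval] at hb
  simpa using hb

lemma exists_intCast_eq_of_abs_eq {x : ℝ} {k : ℤ} (h : |x| = k) : ∃ b : ℤ, (b : ℝ) = x := by
  rcases abs_choice x with hx | hx
  · exact ⟨k, by rw [← h, hx]⟩
  · exact ⟨-k, by rw [Int.cast_neg, ← h, hx, neg_neg]⟩

namespace SimpleMonic

lemma re_residue_ne_zero (hP : SimpleMonic P) {r : ℝ} (h : (r : ℂ) ∈ complexRoots P) :
    (residue P r).re ≠ 0 := by
  have hconj : starRingEnd ℂ (residue P r) = residue P r := by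
    rw [← residue_conj, Complex.conj_ofReal]
  intro h₀
  rw [Complex.conj_eq_iff_re, h₀, Complex.ofReal_zero] at hconj
  exact hP.residue_ne_zero h hconj.symm

lemma inv_norm_sub_one_le_tsum_norm_rho (hP : SimpleMonic P) (hh : Hyperbolic P)
    (hdeg : P.natDegree = 1) {α : ℂ} (hα : α ∈ expandingRoots P) :
    (‖α‖ - 1)⁻¹ ≤ ∑' n, ‖rho P n‖ := by
  obtain ⟨hroot, hnorm⟩ := mem_expandingRoots.1 hα
  have hsingle : expandingRoots P = {α} :=
    (Finset.card_eq_one.1 (hP.card_complexRoots.trans hdeg)).elim fun β hβ => by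
      rw [hβ, Finset.mem_singleton] at hroot
      refine Finset.Subset.antisymm ?_ (Finset.singleton_subset_iff.2 hα)
      rw [hroot, ← hβ]
      exact Finset.filter_subset _ _
  have hres : residue P α = 1 := by
    rw [residue, hP.monic.eq_X_add_C hdeg]
    simp
  have hrho : ∀ n : ℕ, ‖rho P (-n)‖ = ‖α‖⁻¹ * ‖α‖⁻¹ ^ n := fun n => by
    rw [hP.rho_neg, hsingle, Finset.sum_singleton, hres, one_mul, norm_mul, norm_pow, norm_inv]
  have hgeom : HasSum (fun n : ℕ => ‖rho P (-n)‖) (‖α‖ - 1)⁻¹ := by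
    have h := (hasSum_geometric_of_lt_one (inv_nonneg.2 (norm_nonneg α))
      (inv_lt_one_of_one_lt₀ hnorm)).mul_left ‖α‖⁻¹
    rw [← mul_inv, mul_one_sub, mul_inv_cancel₀ (one_pos.trans hnorm).ne'] at h
    simpa only [hrho] using h
  rw [← hgeom.tsum_eq]
  exact tsum_comp_le_tsum_of_inj (hP.summable_norm_rho hh) (fun _ => norm_nonneg _)
    (neg_injective.comp Nat.cast_injective)

/-- Equality would make `r` an integer root, hence `P = X - r` and `∑ |ρ_n| ≥ 1 / (2 M)`. -/
lemma abs_expanding_lt (hP : SimpleMonic P) (hh : Hyperbolic P)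
    (hroot : P.natDegree = 1 ∨ ∀ b : ℤ, ¬P.IsRoot b) {M : ℤ} {r : ℝ}
    (hr : (r : ℂ) ∈ expandingRoots P) (hM : |r| ≤ 2 * M + 1)
    (hlt : M * ∑' n, ‖rho P n‖ < 1 / 2) : |r| < 2 * M + 1 := by
  refine hM.lt_of_ne fun heq => ?_
  obtain ⟨hmem, hnorm⟩ := mem_expandingRoots.1 hr
  rw [Complex.norm_real, Real.norm_eq_abs] at hnorm
  obtain ⟨b, rfl⟩ := exists_intCast_eq_of_abs_eq (k := 2 * M + 1) (by exact_mod_cast heq)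
  rw [Complex.ofReal_intCast] at hmem
  have hdeg := hroot.resolve_right fun h => h b (isRoot_of_intCast_mem hP.monic.ne_zero hmem)
  have hsum := hP.inv_norm_sub_one_le_tsum_norm_rho hh hdeg hr
  rw [Complex.norm_real, Real.norm_eq_abs, heq, add_sub_cancel_right] at hsum
  have hMpos : (0 : ℝ) < M := by linarith
  have hhalf : M * (2 * M : ℝ)⁻¹ = 1 / 2 := by field_simp
  exact hlt.not_ge (hhalf ▸ mul_le_mul_of_nonneg_left hsum hMpos.le)

/-- A rational root of the monic polynomial `P` is an integer, and none lies in `(-1, 1)`. -/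
lemma inv_nonexpanding_ne_intCast (hP : SimpleMonic P) (hh : Hyperbolic P) {r : ℝ}
    (hr : (r : ℂ) ∈ nonexpandingRoots P) (b : ℤ) : (b : ℝ) ≠ r⁻¹ := by
  intro hb
  have hmem := (mem_nonexpandingRoots.1 hr).1
  have hr₀ : r ≠ 0 := Complex.ofReal_ne_zero.1 (hP.ne_zero_of_mem hmem)
  have hnorm : |r| < 1 := by simpa using hh.norm_lt_one hr
  have hrb : r = ((b : ℚ)⁻¹ : ℚ) := by
    rw [Rat.cast_inv, Rat.cast_intCast, hb, inv_inv]
  have hroot : aeval (b : ℚ)⁻¹ P = 0 := by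
    have h : aeval (algebraMap ℚ ℂ (b : ℚ)⁻¹) P = 0 := by
      simpa [hrb] using (mem_complexRoots hP.monic.ne_zero).1 hmem
    rw [aeval_algebraMap_apply] at h
    simpa using h
  obtain ⟨c, hc⟩ := isInteger_of_is_root_of_monic hP.monic hroot
  have hcr : (c : ℝ) = r := by
    rw [hrb, ← hc]
    simp
  rw [← hcr] at hnorm hr₀
  have hc₀ : c = 0 := Int.abs_lt_one_iff.1 (by exact_mod_cast hnorm)
  exact hr₀ (Int.cast_eq_zero.2 hc₀)

end SimpleMonic

end IntegerRoots

section Interval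

variable {P : ℤ[X]} {M : ℤ} {α₀ : ℂ}

lemma tsum_abs_re_rho_neg (P : ℤ[X]) : ∑' k, |(rho P (-k)).re| = ∑' k, |(rho P k).re| :=
  (Equiv.neg ℤ).tsum_eq fun k => |(rho P k).re|

namespace SimpleMonic

lemma mul_tsum_abs_re_rho_lt (hP : SimpleMonic P) (hh : Hyperbolic P) (hM : 0 ≤ M) {y : ℝ}
    (h : M * ∑' n, ‖rho P n‖ < y) : M * ∑' n, |(rho P n).re| < y := by
  refine lt_of_le_of_lt (mul_le_mul_of_nonneg_left ?_ (Int.cast_nonneg hM)) h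
  exact (hP.summable_re_rho hh).abs.tsum_le_tsum (fun n => Complex.abs_re_le_norm _)
    (hP.summable_norm_rho hh)

theorem digitKernel_of_expanding (hP : SimpleMonic P) (hh : Hyperbolic P)
    (hroot : P.natDegree = 1 ∨ ∀ b : ℤ, ¬P.IsRoot b) (h₀ : α₀ ∈ expandingRoots P)
    (hmin : ∀ α ∈ expandingRoots P, α ≠ α₀ → ‖α₀‖ < ‖α‖) (hM : ‖α₀‖ ≤ 2 * M + 1)
    (hlt : M * ∑' n, ‖rho P n‖ < 1 / 2) :
    ∃ a, DigitKernel (fun k => (rho P (-k)).re) M a := by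
  obtain ⟨r, rfl⟩ := exists_ofReal_eq_of_conj_mem
    (fun _ => conj_mem_expandingRoots hP.monic.ne_zero) h₀ fun α hα hne => (hmin α hα hne).ne'
  obtain ⟨hmem, hnorm⟩ := mem_expandingRoots.1 h₀
  have hr₀ := hP.ne_zero_of_mem hmem
  rw [Complex.norm_real, Real.norm_eq_abs] at hnorm hM
  have hM₀ : 0 ≤ M := by exact_mod_cast (by linarith : (0 : ℝ) ≤ M)
  refine ⟨r, hP.summable_re_rho_neg hh, tendsto_div_succ_of_tendsto_nat ?_, hnorm,
    hP.abs_expanding_lt hh hroot h₀ hM hlt, ?_⟩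
  · have hc : (residue P r * (r : ℂ)⁻¹).re ≠ 0 := by
      rw [← Complex.ofReal_inv, Complex.re_mul_ofReal]
      exact mul_ne_zero (hP.re_residue_ne_zero hmem) (inv_ne_zero (Complex.ofReal_ne_zero.1 hr₀))
    have hratio := tendsto_re_sum_div_re_sum_succ (c := fun α => residue P α * α⁻¹)
      (z := fun α => α⁻¹) h₀ (inv_mul_cancel₀ hr₀) hc fun α hα hne => by
        have h := hmin α hα hne
        rwa [norm_mul, norm_inv, inv_mul_lt_one₀ ((norm_nonneg _).trans_lt h)]
    simpa only [← hP.rho_neg, Nat.cast_add, Nat.cast_one] using hratio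
  · rw [tsum_abs_re_rho_neg]
    exact hP.mul_tsum_abs_re_rho_lt hh hM₀ hlt

theorem digitKernel_of_nonexpanding (hP : SimpleMonic P) (hh : Hyperbolic P)
    (h₀ : α₀ ∈ nonexpandingRoots P)
    (hmin : ∀ α ∈ nonexpandingRoots P, α ≠ α₀ → ‖α₀‖⁻¹ < ‖α‖⁻¹) (hM : ‖α₀‖⁻¹ ≤ 2 * M + 1)
    (hlt : M * ∑' n, ‖rho P n‖ < 1 / 2) :
    ∃ a, DigitKernel (fun k => (rho P k).re) M a := by
  obtain ⟨r, rfl⟩ := exists_ofReal_eq_of_conj_mem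
    (fun _ => conj_mem_nonexpandingRoots hP.monic.ne_zero) h₀
    fun α hα hne h => (hmin α hα hne).ne (by rw [h])
  have hmem := (mem_nonexpandingRoots.1 h₀).1
  have hr₀ := hP.ne_zero_of_mem hmem
  have hpos : 0 < ‖(r : ℂ)‖ := norm_pos_iff.2 hr₀
  have hone : 1 < |r⁻¹| := by
    rw [abs_inv, ← Real.norm_eq_abs, ← Complex.norm_real]
    exact (one_lt_inv₀ hpos).2 (hh.norm_lt_one h₀)
  rw [Complex.norm_real, Real.norm_eq_abs, ← abs_inv] at hM
  have hM₀ : 0 ≤ M := by exact_mod_cast (by linarith : (0 : ℝ) ≤ M)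
  have hM' : |r⁻¹| < 2 * M + 1 := hM.lt_of_ne fun heq => by
    obtain ⟨b, hb⟩ := exists_intCast_eq_of_abs_eq (k := 2 * M + 1) (by exact_mod_cast heq)
    exact hP.inv_nonexpanding_ne_intCast hh h₀ b hb
  refine ⟨r⁻¹, hP.summable_re_rho hh, tendsto_div_succ_of_tendsto_nat ?_, hone, hM',
    hP.mul_tsum_abs_re_rho_lt hh hM₀ hlt⟩
  rw [← tendsto_add_atTop_iff_nat 1]
  have hratio := tendsto_re_sum_div_re_sum_succ (c := fun α => -residue P α) (z := id)
    (a := r⁻¹) h₀ (by simpa using mul_inv_cancel₀ hr₀)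
    (neg_ne_zero.2 (hP.re_residue_ne_zero hmem)) fun α hα hne => by
      have h := (inv_lt_inv₀ hpos (norm_pos_iff.2 (hP.ne_zero_of_mem
        (mem_nonexpandingRoots.1 hα).1))).1 (hmin α hα hne)
      rwa [Complex.ofReal_inv, norm_mul, norm_inv, mul_inv_lt_iff₀ hpos, one_mul]
  simpa only [id, ← hP.rho_succ, Nat.cast_add, Nat.cast_one] using hratio

theorem exists_Icc_subset_spectrum_of_expanding (hP : SimpleMonic P) (hh : Hyperbolic P)
    (hroot : P.natDegree = 1 ∨ ∀ b : ℤ, ¬P.IsRoot b) (h₀ : α₀ ∈ expandingRoots P)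
    (hmin : ∀ α ∈ expandingRoots P, α ≠ α₀ → ‖α₀‖ < ‖α‖) (hM : ‖α₀‖ ≤ 2 * M + 1)
    (hlt : M * ∑' n, ‖rho P n‖ < 1 / 2) : ∃ v < 1 / 2, Set.Icc v (1 / 2) ⊆ spectrum 0 P := by
  obtain ⟨a, hkernel⟩ := hP.digitKernel_of_expanding hh hroot h₀ hmin hM hlt
  obtain ⟨v, hv, hMv, hdigits⟩ := hkernel.exists_distInt_eq
  refine ⟨v, hv, fun y hy => ?_⟩
  obtain ⟨m, s, hs, ⟨n, rfl⟩, hle⟩ := hdigits y hy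
  exact hP.distInt_shiftSum_mem_spectrum hh hs (hMv.trans hy.1) hle

theorem exists_Icc_subset_spectrum_of_nonexpanding (hP : SimpleMonic P) (hh : Hyperbolic P)
    (h₀ : α₀ ∈ nonexpandingRoots P)
    (hmin : ∀ α ∈ nonexpandingRoots P, α ≠ α₀ → ‖α₀‖⁻¹ < ‖α‖⁻¹) (hM : ‖α₀‖⁻¹ ≤ 2 * M + 1)
    (hlt : M * ∑' n, ‖rho P n‖ < 1 / 2) : ∃ v < 1 / 2, Set.Icc v (1 / 2) ⊆ spectrum 0 P := by
  obtain ⟨a, hkernel⟩ := hP.digitKernel_of_nonexpanding hh h₀ hmin hM hlt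
  obtain ⟨v, hv, hMv, hdigits⟩ := hkernel.exists_distInt_eq
  refine ⟨v, hv, fun y hy => ?_⟩
  obtain ⟨m, s, hs, ⟨n, rfl⟩, hle⟩ := hdigits y hy
  have hMy := hMv.trans hy.1
  simp only [shiftSum_neg (fun k => (rho P k).re), ← tsum_abs_re_rho_neg P] at hle hMy ⊢
  exact hP.distInt_shiftSum_mem_spectrum hh (m := -m) (fun j hj => hs _ fun h => hj (by omega)) hMy
    fun k => by simpa using hle (-k)

end SimpleMonic

end Interval

section Beta

variable {P : ℤ[X]}

lemma zero_mem_lowerBounds_expandingModuli (P : ℤ[X]) : 0 ∈ lowerBounds (expandingModuli P) := by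
  rintro _ ⟨α, -, rfl⟩
  exact norm_nonneg α

lemma zero_mem_lowerBounds_nonexpandingInvModuli (P : ℤ[X]) :
    0 ∈ lowerBounds (nonexpandingInvModuli P) := by
  rintro _ ⟨α, -, rfl⟩
  exact inv_nonneg.2 (norm_nonneg α)

lemma beta₁_le {α : ℂ} (h : α ∈ expandingRoots P) : beta₁ P ≤ ‖α‖ :=
  csInf_le ⟨0, zero_mem_lowerBounds_expandingModuli P⟩ ⟨α, h, rfl⟩

lemma beta₂_le {α : ℂ} (h : α ∈ nonexpandingRoots P) : beta₂ P ≤ ‖α‖⁻¹ :=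
  csInf_le ⟨0, zero_mem_lowerBounds_nonexpandingInvModuli P⟩ ⟨α, h, rfl⟩

lemma bddBelow_moduli (P : ℤ[X]) : BddBelow (expandingModuli P ∪ nonexpandingInvModuli P) :=
  BddBelow.union ⟨0, zero_mem_lowerBounds_expandingModuli P⟩
    ⟨0, zero_mem_lowerBounds_nonexpandingInvModuli P⟩

lemma beta₁_eq_beta (h : ∃ α ∈ expandingRoots P, ‖α‖ = beta P) : beta₁ P = beta P := by
  obtain ⟨α, hα, hbeta⟩ := h
  exact le_antisymm ((beta₁_le hα).trans_eq hbeta)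
    (csInf_le_csInf (bddBelow_moduli P) ⟨_, α, hα, rfl⟩ Set.subset_union_left)

lemma beta₂_eq_beta (h : ∃ α ∈ nonexpandingRoots P, ‖α‖⁻¹ = beta P) : beta₂ P = beta P := by
  obtain ⟨α, hα, hbeta⟩ := h
  exact le_antisymm ((beta₂_le hα).trans_eq hbeta)
    (csInf_le_csInf (bddBelow_moduli P) ⟨_, α, hα, rfl⟩ Set.subset_union_right)

lemma le_two_mul_ceil_add_one (x : ℝ) : x ≤ 2 * (⌈(x - 1) / 2⌉ : ℝ) + 1 := by
  linarith [Int.le_ceil ((x - 1) / 2)]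

lemma ceil_mul_le_ceil_mul {x y S : ℝ} (hxy : x ≤ y) (hS : 0 ≤ S) :
    (⌈(x - 1) / 2⌉ : ℝ) * S ≤ ⌈(y - 1) / 2⌉ * S := by
  gcongr

theorem SimpleMonic.exists_Icc_subset_spectrum_of_existsUnique_beta₁ (hP : SimpleMonic P)
    (hh : Hyperbolic P) (hroot : P.natDegree = 1 ∨ ∀ b : ℤ, ¬P.IsRoot b)
    (hβ : ∃! α : ℂ, α ∈ expandingRoots P ∧ ‖α‖ = beta₁ P)
    (hlt : (⌈(beta₁ P - 1) / 2⌉ : ℝ) * ∑' n, ‖rho P n‖ < 1 / 2) :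
    ∃ v < 1 / 2, Set.Icc v (1 / 2) ⊆ spectrum 0 P := by
  obtain ⟨α₀, ⟨h₀, hα₀⟩, huniq⟩ := hβ
  refine hP.exists_Icc_subset_spectrum_of_expanding hh hroot h₀ (fun α hα hne => ?_)
    (hα₀ ▸ le_two_mul_ceil_add_one _) hlt
  exact hα₀ ▸ (beta₁_le hα).lt_of_ne' fun h => hne (huniq α ⟨hα, h⟩)

theorem SimpleMonic.exists_Icc_subset_spectrum_of_existsUnique_beta₂ (hP : SimpleMonic P)
    (hh : Hyperbolic P) (hβ : ∃! α : ℂ, α ∈ nonexpandingRoots P ∧ ‖α‖⁻¹ = beta₂ P)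
    (hlt : (⌈(beta₂ P - 1) / 2⌉ : ℝ) * ∑' n, ‖rho P n‖ < 1 / 2) :
    ∃ v < 1 / 2, Set.Icc v (1 / 2) ⊆ spectrum 0 P := by
  obtain ⟨α₀, ⟨h₀, hα₀⟩, huniq⟩ := hβ
  refine hP.exists_Icc_subset_spectrum_of_nonexpanding hh h₀ (fun α hα hne => ?_)
    (hα₀ ▸ le_two_mul_ceil_add_one _) hlt
  exact hα₀ ▸ (beta₂_le hα).lt_of_ne' fun h => hne (huniq α ⟨hα, h⟩)

end Beta

namespace Admissible

variable {P : ℤ[X]}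

lemma simpleMonic (hP : Admissible P) (hm : P.Monic) : SimpleMonic P :=
  ⟨hm, hP.one_le_natDegree, hP.coeff_zero_ne, hP.nodup_roots⟩

lemma natDegree_eq_one_or_forall_not_isRoot (hP : Admissible P) (hm : P.Monic) :
    P.natDegree = 1 ∨ ∀ b : ℤ, ¬P.IsRoot b := by
  refine or_iff_not_imp_right.2 fun h => ?_
  push Not at h
  obtain ⟨b, hb⟩ := h
  have hassoc :=
    (hP.irreducible.dvd_iff.1 (dvd_iff_isRoot.2 hb)).resolve_left (not_isUnit_X_sub_C b)
  rw [eq_of_monic_of_associated hm (monic_X_sub_C b) hassoc, natDegree_X_sub_C]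

end Admissible

lemma exists_seq_Icc_subset {S : Set ℝ} {b : ℝ} (h : ∃ v < b, Set.Icc v b ⊆ S) :
    ∃ c d : ℕ → ℝ, (∀ i, c i < d i ∧ Set.Icc (c i) (d i) ⊆ S) ∧ Tendsto c atTop (𝓝 b) := by
  obtain ⟨v, hv, hS⟩ := h
  obtain ⟨c, -, hc, hlim⟩ := exists_seq_strictMono_tendsto' hv
  exact ⟨c, fun _ => b, fun i => ⟨(hc i).2, (Set.Icc_subset_Icc_left (hc i).1.le).trans hS⟩, hlim⟩

end MarkoffLagrange

open MarkoffLagrange in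
theorem theorem4p3_general {P : ℤ[X]} (hP : SimpleMonic P) (hh : Hyperbolic P) :
    (∀ k : ℕ, AccPt (1 / 2 : ℝ) (𝓟 (spectrum k P))) ∧
    ((P.natDegree = 1 ∨ ∀ b : ℤ, ¬P.IsRoot b) ∧
        (∃! α : ℂ, α ∈ expandingRoots P ∧ ‖α‖ = beta P) ∨
        (∃! α : ℂ, α ∈ nonexpandingRoots P ∧ ‖α‖⁻¹ = beta P) →
      (⌈(beta P - 1) / 2⌉ : ℝ) * ∑' n : ℤ, ‖rho P n‖ < 1 / 2 →
      ∃ v < 1 / 2, Set.Icc v (1 / 2) ⊆ spectrum 0 P) ∧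
    ((P.natDegree = 1 ∨ ∀ b : ℤ, ¬P.IsRoot b) →
      (∃! α : ℂ, α ∈ expandingRoots P ∧ ‖α‖ = beta₁ P) →
      (⌈(beta₁ P - 1) / 2⌉ : ℝ) * ∑' n : ℤ, ‖rho P n‖ < 1 / 2 →
      ∃ v < 1 / 2, Set.Icc v (1 / 2) ⊆ spectrum 0 P) ∧
    ((∃! α : ℂ, α ∈ nonexpandingRoots P ∧ ‖α‖⁻¹ = beta₂ P) →
      (⌈(beta₂ P - 1) / 2⌉ : ℝ) * ∑' n : ℤ, ‖rho P n‖ < 1 / 2 →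
      ∃ v < 1 / 2, Set.Icc v (1 / 2) ⊆ spectrum 0 P) := by
  refine ⟨hP.accPt_spectrum hh, fun hβ hlt => ?_,
    hP.exists_Icc_subset_spectrum_of_existsUnique_beta₁ hh,
    hP.exists_Icc_subset_spectrum_of_existsUnique_beta₂ hh⟩
  rcases hβ with ⟨hroot, hβ⟩ | hβ
  · have hbeta := beta₁_eq_beta hβ.exists
    rw [← hbeta] at hβ hlt
    exact hP.exists_Icc_subset_spectrum_of_existsUnique_beta₁ hh hroot hβ hlt
  · have hbeta := beta₂_eq_beta hβ.exists
    rw [← hbeta] at hβ hlt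
    exact hP.exists_Icc_subset_spectrum_of_existsUnique_beta₂ hh hβ hlt

theorem theorem4p3 (P : Polynomial ℤ) (hP : MarkoffLagrange.Admissible P) (hmonic : P.Monic)
    (hhyp : MarkoffLagrange.Hyperbolic P) :
    (∀ k : ℕ, AccPt (1 / 2 : ℝ) (𝓟 (MarkoffLagrange.spectrum k P))) ∧
    (((∃! α : ℂ, α ∈ MarkoffLagrange.expandingRoots P ∧ ‖α‖ = MarkoffLagrange.beta P) ∨
        (∃! α : ℂ, α ∈ MarkoffLagrange.nonexpandingRoots P ∧ ‖α‖⁻¹ = MarkoffLagrange.beta P)) →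
      (⌈(MarkoffLagrange.beta P - 1) / 2⌉ : ℝ) * ∑' n : ℤ, ‖MarkoffLagrange.rho P n‖ < 1 / 2 →
      ∃ c d : ℕ → ℝ,
        (∀ i, c i < d i ∧ Set.Icc (c i) (d i) ⊆ MarkoffLagrange.spectrum 0 P) ∧
        Tendsto c atTop (𝓝 (1 / 2))) ∧
    ((∃! α : ℂ, α ∈ MarkoffLagrange.expandingRoots P ∧ ‖α‖ = MarkoffLagrange.beta₁ P) →
      (∃! α : ℂ, α ∈ MarkoffLagrange.nonexpandingRoots P ∧ ‖α‖⁻¹ = MarkoffLagrange.beta₂ P) →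
      (⌈(max (MarkoffLagrange.beta₁ P) (MarkoffLagrange.beta₂ P) - 1) / 2⌉ : ℝ) *
        ∑' n : ℤ, ‖MarkoffLagrange.rho P n‖ < 1 / 2 →
      ∃ v : ℝ, v < 1 / 2 ∧ Set.Icc v (1 / 2) ⊆ MarkoffLagrange.spectrum 0 P) := by
  have hroot := hP.natDegree_eq_one_or_forall_not_isRoot hmonic
  obtain ⟨h₁, h₂, h₃, -⟩ := theorem4p3_general (hP.simpleMonic hmonic) hhyp
  exact ⟨h₁, fun hβ hlt =>
    MarkoffLagrange.exists_seq_Icc_subset (h₂ (hβ.imp_left (.intro hroot)) hlt),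
    fun hβ _ hlt => h₃ hroot hβ ((MarkoffLagrange.ceil_mul_le_ceil_mul (le_max_left _ _)
      (tsum_nonneg fun _ => norm_nonneg _)).trans_lt hlt)⟩
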